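/- \textbf{Setting.} Let $A\in\mathbb R^{n\times n}$, $B\in\mathbb R^{n\times l}$ with $(A,B)$ stabilizable, $E\in\mathbb R^{n\times m}$, $z\in\mathbb R^n$; let $Q_1,Q_2\in\mathbb R^{n\times n}$ and $R_1,R_2\in\mathbb R^{l\times l}$ be symmetric with $Q_1,Q_2,R_2\ge 0$, $R_1>0$; let $s\in\mathbb R^n$, $v\in\mathbb R^l$, $c\in\mathbb R$. On a probability space $(\Omega,\mathcal F,\mathbb P)$ let $W(0),W(1),\dots$ be i.i.d. $\mathbb R^m$-valued random variables whose law $\varrho_W$ has finite second moment and mean $\mu_W$, and assume that for every $\varrho_0\in\mathcal P_2(\mathbb R^n)$ (probability measures with finite second moment) the space carries a random variable $X_0\sim\varrho_0$ independent of the sequence $W(\cdot)$. Put $f(X,U,W)=AX+BU+EW+z$, $\|x\|_M^2=x^TMx$, and, for $X\in L^2(\Omega;\mathbb R^n)$, $U\in L^2(\Omega;\mathbb R^l)$, $$\ell(X,U)=\mathbb E\big[X^TQ_1X+U^TR_1U+s^TX+v^TU+c\big]+\mathrm{Tr}(Q_2\,\mathrm{Cov}(X))+\mathrm{Tr}(R_2\,\mathrm{Cov}(U)).$$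 \textbf{Theorem.} Assume that $(x^s,u^s)\in\mathbb R^n\times\mathbb R^l$ satisfies $(I-A)x^s-Bu^s=E\mu_W+z$ and that $(A,Q_1^{1/2})$ is detectable. Then the following hold. (i) The Riccati equation $$P=A^TPA+(Q_1+Q_2)-A^TPB\,[(R_1+R_2)+B^TPB]^{-1}B^TPA$$ has exactly one symmetric positive semidefinite solution $P$. Put $K=-[(R_1+R_2)+B^TPB]^{-1}B^TPA$. (ii) There are a symmetric positive definite $S\in\mathbb R^{n\times n}$, a vector $q\in\mathbb R^n$, a pair $(\tilde x^s_\star,\tilde u^s_\star)\in\mathbb R^n\times\mathbb R^l$ with $(I-A)\tilde x^s_\star-B\tilde u^s_\star=0$, and $r>0$ such that, with $\alpha(t)=rt$, with $\tilde\lambda(X)=\mathbb E[\|X\|_S^2+q^TX]$, and with $\hat\ell$ denoting the cost $\ell$ in which $s,v,c$ are replaced by $s+2Q_1x^s$, $v+2R_1u^s$ and ${x^s}^TQ_1x^s+{u^s}^TR_1u^s+s^Tx^s+v^Tu^s+c$, one has for all $\tilde X\in L^2(\Omega;\mathbb R^n)$, $\tilde U\in L^2(\Omega;\mathbb R^l)$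 $$\hat\ell(\tilde X,\tilde U)-\hat\ell(\tilde x^s_\star,\tilde u^s_\star)+\tilde\lambda(\tilde X)-\tilde\lambda(A\tilde X+B\tilde U)\ \ge\ \alpha\big(\mathbb E\|\tilde X-\tilde x^s_\star\|^2\big),$$ and moreover (iii) and (iv) hold with these data. (iii) There are a distribution $\varrho_X^{s,\star}\in\mathcal P_2(\mathbb R^n)$ and an initial value $X^s_\star(0)\sim\varrho_X^{s,\star}$, independent of the sequence $W(\cdot)$, such that the processes $$X^s_\star(k+1)=f(X^s_\star(k),U^s_\star(k),W(k)),\qquad U^s_\star(k)=K(X^s_\star(k)-\tilde x^s_\star-x^s)+\tilde u^s_\star+u^s$$ form a stationary pair: for all $k\in\mathbb N_0$, $X^s_\star(k)\sim\varrho_X^{s,\star}$, $U^s_\star(k)\sim\varrho_U$ for a fixed $\varrho_U\in\mathcal P_2(\mathbb R^l)$, and $W(k)$ is independent of $X^s_\star(k)$ and of $U^s_\star(k)$. The distribution $\varrho_X^{s,\star}$ is invariant for the Markov chain given by this closed loop. (iv) The stochastic linear-quadratic problem with dynamics $f$ and stage cost $\ell$ is strictly dissipative in $L^2$ at $(X^s_\star(\cdot),U^s_\star(\cdot))$,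 with storage function $$\lambda(k,X)=\mathbb E\Big[\|X-(X^s_\star(k)-\tilde x^s_\star)\|_{P+S}^2-\|X-x^s\|_P^2+q^T\big(X-(X^s_\star(k)-\tilde x^s_\star)\big)\Big]$$ and $\alpha(t)=rt$. That is, $\lambda$ is bounded from below uniformly in $k\in\mathbb N_0$ and $X\in L^2(\Omega;\mathbb R^n)$, and for all $k\in\mathbb N_0$ and all $X\in L^2(\Omega;\mathbb R^n)$, $U\in L^2(\Omega;\mathbb R^l)$ that are each independent of $W(k)$, $$\ell(X,U)-\ell(X^s_\star(k),U^s_\star(k))+\lambda(k,X)-\lambda\big(k+1,f(X,U,W(k))\big)\ \ge\ \alpha\big(\mathbb E\|X-X^s_\star(k)\|^2\big).$$ -/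

import Mathlib

open MeasureTheory ProbabilityTheory
open scoped Matrix MatrixOrder

noncomputable section

namespace StochLQ

/-- Euclidean space `ℝᵈ`. -/
abbrev Vec (d : ℕ) : Type := EuclideanSpace ℝ (Fin d)

/-- Matrix-vector product on Euclidean spaces. -/
abbrev act {a b : ℕ} (M : Matrix (Fin a) (Fin b) ℝ) (x : Vec b) : Vec a :=
  Matrix.toEuclideanLin M x

/-- The quadratic form `‖x‖_M² = xᵀ M x`. -/
def quad {d : ℕ} (M : Matrix (Fin d) (Fin d) ℝ) (x : Vec d) : ℝ :=
  inner ℝ x (act M x)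

/-- All complex eigenvalues lie in the open unit disc. -/
def IsSchurStable {d : ℕ} (M : Matrix (Fin d) (Fin d) ℝ) : Prop :=
  ∀ ζ ∈ spectrum ℂ (M.map (algebraMap ℝ ℂ)), ‖ζ‖ < 1

/-- `(A, B)` is stabilizable. -/
def IsStabilizable {n l : ℕ} (A : Matrix (Fin n) (Fin n) ℝ) (B : Matrix (Fin n) (Fin l) ℝ) :
    Prop :=
  ∃ F : Matrix (Fin l) (Fin n) ℝ, IsSchurStable (A + B * F)

/-- `(A, C)` is detectable. -/
def IsDetectable {n d : ℕ} (A : Matrix (Fin n) (Fin n) ℝ) (C : Matrix (Fin d) (Fin n) ℝ) :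
    Prop :=
  ∃ L : Matrix (Fin n) (Fin d) ℝ, IsSchurStable (A + L * C)

/-- The class `𝒦_∞` of comparison functions on `[0, ∞)`. -/
structure IsClassKInfty (α : ℝ → ℝ) : Prop where
  continuousOn : ContinuousOn α (Set.Ici 0)
  strictMonoOn : StrictMonoOn α (Set.Ici 0)
  map_zero : α 0 = 0
  unbounded : ∀ c : ℝ, ∃ t : ℝ, 0 ≤ t ∧ c < α t

/-- Probability measures with finite second moment. -/
structure IsP2 {d : ℕ} (ρ : Measure (Vec d)) : Prop where
  isProbabilityMeasure : IsProbabilityMeasure ρ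
  integrable_sq : Integrable (fun x => ‖x‖ ^ 2) ρ

/-- The coefficients of the linear dynamics `x⁺ = A x + B u + E w + z`. -/
structure Dynamics (n l m : ℕ) where
  A : Matrix (Fin n) (Fin n) ℝ
  B : Matrix (Fin n) (Fin l) ℝ
  E : Matrix (Fin n) (Fin m) ℝ
  z : Vec n

/-- The right-hand side `f(x, u, w)` of the dynamics. -/
def Dynamics.f {n l m : ℕ} (D : Dynamics n l m) (x : Vec n) (u : Vec l) (w : Vec m) : Vec n :=
  act D.A x + act D.B u + act D.E w + D.z

/-- The coefficients of the stage cost. -/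
structure Cost (n l : ℕ) where
  Q₁ : Matrix (Fin n) (Fin n) ℝ
  Q₂ : Matrix (Fin n) (Fin n) ℝ
  R₁ : Matrix (Fin l) (Fin l) ℝ
  R₂ : Matrix (Fin l) (Fin l) ℝ
  s : Vec n
  v : Vec l
  c : ℝ

/-- The covariance matrix of a random vector. -/
def covMat {Ω : Type*} [MeasurableSpace Ω] (μ : Measure Ω) {d : ℕ} (X : Ω → Vec d) :
    Matrix (Fin d) (Fin d) ℝ :=
  Matrix.of fun i j => covariance (fun ω => X ω i) (fun ω => X ω j) μ

/-- The stage cost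
`ℓ(X, U) = 𝔼[Xᵀ Q₁ X + Uᵀ R₁ U + sᵀ X + vᵀ U + c] + Tr(Q₂ Cov X) + Tr(R₂ Cov U)`. -/
def Cost.ell {n l : ℕ} (C : Cost n l) {Ω : Type*} [MeasurableSpace Ω] (μ : Measure Ω)
    (X : Ω → Vec n) (U : Ω → Vec l) : ℝ :=
  (∫ ω, (quad C.Q₁ (X ω) + quad C.R₁ (U ω) + inner ℝ C.s (X ω) + inner ℝ C.v (U ω) + C.c) ∂μ)
    + (C.Q₂ * covMat μ X).trace + (C.R₂ * covMat μ U).trace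

/-- The cost coefficients after the change of variables `x = x̂ + xs`, `u = û + us`. -/
def Cost.shift {n l : ℕ} (C : Cost n l) (xs : Vec n) (us : Vec l) : Cost n l where
  Q₁ := C.Q₁
  Q₂ := C.Q₂
  R₁ := C.R₁
  R₂ := C.R₂
  s := C.s + (2 : ℝ) • act C.Q₁ xs
  v := C.v + (2 : ℝ) • act C.R₁ us
  c := quad C.Q₁ xs + quad C.R₁ us + inner ℝ C.s xs + inner ℝ C.v us + C.c

/-- `P` is a positive semidefinite solution of the discrete-time algebraic Riccati equation with
weights `Q₁ + Q₂` and `R₁ + R₂`. -/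
def IsRiccatiSolution {n l m : ℕ} (D : Dynamics n l m) (C : Cost n l)
    (P : Matrix (Fin n) (Fin n) ℝ) : Prop :=
  P.PosSemidef ∧
    P = D.Aᵀ * P * D.A + (C.Q₁ + C.Q₂)
      - D.Aᵀ * P * D.B * ((C.R₁ + C.R₂) + D.Bᵀ * P * D.B)⁻¹ * D.Bᵀ * P * D.A

/-- The feedback gain `K = -[(R₁ + R₂) + Bᵀ P B]⁻¹ Bᵀ P A`. -/
def gain {n l m : ℕ} (D : Dynamics n l m) (C : Cost n l) (P : Matrix (Fin n) (Fin n) ℝ) :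
    Matrix (Fin l) (Fin n) ℝ :=
  -(((C.R₁ + C.R₂) + D.Bᵀ * P * D.B)⁻¹ * D.Bᵀ * P * D.A)

/-- `ρ` is invariant under the Markov chain `x⁺ = f(x, π x, w)` with noise law `ρW`. -/
def IsInvariant {n l m : ℕ} (D : Dynamics n l m) (ρW : Measure (Vec m))
    (π : Vec n → Vec l) (ρ : Measure (Vec n)) : Prop :=
  (ρ.prod ρW).map (fun p => D.f p.1 (π p.1) p.2) = ρ

/-- `(Xs, Us)` is a stationary pair with marginal laws `ρX` and `ρU`, driven by the noise `W`. As
for all state and control processes, `W k` is independent of `Xs k` and of `Us k`. -/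
structure IsStationaryPair {n l m : ℕ} (D : Dynamics n l m) {Ω : Type*} [MeasurableSpace Ω]
    (μ : Measure Ω) (W : ℕ → Ω → Vec m) (Xs : ℕ → Ω → Vec n) (Us : ℕ → Ω → Vec l)
    (ρX : Measure (Vec n)) (ρU : Measure (Vec l)) : Prop where
  isP2_state : IsP2 ρX
  isP2_control : IsP2 ρU
  law_state : ∀ k, HasLaw (Xs k) ρX μ
  law_control : ∀ k, HasLaw (Us k) ρU μ
  indep_state : ∀ k, IndepFun (Xs k) (W k) μ
  indep_control : ∀ k, IndepFun (Us k) (W k) μ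
  step : ∀ k ω, Xs (k + 1) ω = D.f (Xs k ω) (Us k ω) (W k ω)

/-- The stochastic optimal control problem is strictly dissipative in `L²` at `(Xs, Us)` with
time-varying storage function `lam` and comparison function `α`. The admissible random variables
at time `k` are the square integrable ones that are independent of the noise `W k`. -/
structure IsStrictlyDissipative {n l m : ℕ} (D : Dynamics n l m) (C : Cost n l)
    {Ω : Type*} [MeasurableSpace Ω] (μ : Measure Ω) (W : ℕ → Ω → Vec m)
    (Xs : ℕ → Ω → Vec n) (Us : ℕ → Ω → Vec l)
    (lam : ℕ → (Ω → Vec n) → ℝ) (α : ℝ → ℝ) : Prop where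
  classKInfty : IsClassKInfty α
  bddBelow : ∃ M : ℝ, ∀ k X, MemLp X 2 μ → M ≤ lam k X
  dissipation : ∀ (k : ℕ) (X : Ω → Vec n) (U : Ω → Vec l), MemLp X 2 μ → MemLp U 2 μ →
    IndepFun X (W k) μ → IndepFun U (W k) μ →
    α (∫ ω, ‖X ω - Xs k ω‖ ^ 2 ∂μ) ≤
      C.ell μ X U - C.ell μ (Xs k) (Us k) + lam k X
        - lam (k + 1) (fun ω => D.f (X ω) (U ω) (W k ω))

/-- The storage function `𝔼[‖X‖_S² + qᵀ X]` of the noise-free error system. -/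
def errorStorage {n : ℕ} {Ω : Type*} [MeasurableSpace Ω] (μ : Measure Ω)
    (S : Matrix (Fin n) (Fin n) ℝ) (q : Vec n) (X : Ω → Vec n) : ℝ :=
  ∫ ω, (quad S (X ω) + inner ℝ q (X ω)) ∂μ

/-- Strict dissipativity of the noise-free error system `X⁺ = A X + B U` with cost `C` at the
point `(xt, ut)`, with storage function `errorStorage μ S q`. -/
def IsErrorDissipative {n l m : ℕ} (D : Dynamics n l m) (C : Cost n l)
    {Ω : Type*} [MeasurableSpace Ω] (μ : Measure Ω) (S : Matrix (Fin n) (Fin n) ℝ)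
    (q xt : Vec n) (ut : Vec l) (α : ℝ → ℝ) : Prop :=
  ∀ (X : Ω → Vec n) (U : Ω → Vec l), MemLp X 2 μ → MemLp U 2 μ →
    α (∫ ω, ‖X ω - xt‖ ^ 2 ∂μ) ≤
      C.ell μ X U - C.ell μ (fun _ => xt) (fun _ => ut) + errorStorage μ S q X
        - errorStorage μ S q (fun ω => act D.A (X ω) + act D.B (U ω))

/-- The storage function
`λ(k, X) = 𝔼[‖X - (Xs(k) - xt)‖_{P+S}² - ‖X - xs‖_P² + qᵀ (X - (Xs(k) - xt))]`. -/
def storage {n : ℕ} {Ω : Type*} [MeasurableSpace Ω] (μ : Measure Ω)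
    (P S : Matrix (Fin n) (Fin n) ℝ) (q xs xt : Vec n) (Xs : ℕ → Ω → Vec n)
    (k : ℕ) (X : Ω → Vec n) : ℝ :=
  ∫ ω, (quad (P + S) (X ω - (Xs k ω - xt)) - quad P (X ω - xs)
    + inner ℝ q (X ω - (Xs k ω - xt))) ∂μ

end StochLQ

end

/-! Put `Y = X - (Xs k - xt)`, `T = U - (Us k - ut)` and `Z = Xs k - xt - xs`, and write `Q = Q₁ +
Q₂`, `R = R₁ + R₂`. Both trajectories see the same noise, so the error obeys the noise-free dynamics
`Y⁺ = A Y + B T`. Since `Z` and `K Z` are centered, the cost difference is the shifted cost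
difference of the error system plus the cross terms `2 𝔼[Yᵀ Q Z] + 2 𝔼[Tᵀ R K Z]`. The `P`-part of
the storage function contributes `-2 𝔼[Yᵀ P Z] - 𝔼‖Z‖_P²`.

The Riccati equation makes `P Z` an adjoint state: `Q Z + Aᵀ P (A + B K) Z = P Z` and `R K Z + Bᵀ P
(A + B K) Z = 0` (`cross_state`, `cross_control`). Hence the cross terms cancel against the change
of storage. The term `𝔼‖Z‖_P²` is constant in time by stationarity, and the remaining noise term
vanishes because `X`, `U` and the stationary pair are each independent of `W k`. What is left is the
dissipation inequality of the error system (`dissipation_of_isErrorDissipative`).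

For the error system, detectability gives a quadratic `S` that is strictly dissipative in the state
(`IsDetectable.exists_storage`). Centering it at the optimal steady state, with the Lagrange
multiplier as linear term, handles the linear part of the cost.

Value iteration from `0` produces a Riccati solution. The same `S` makes `P + S` a Lyapunov function
of its closed loop, which gives uniqueness of `P`. It also gives the invariant law, as the law of a
convergent series in the past noise (`IsLyapunov.exists_invariant`). -/

namespace StochLQ

/-! ### Quadratic forms on Euclidean space -/

section Algebra

variable {a b d : ℕ}

theorem act_mul (M : Matrix (Fin a) (Fin b) ℝ) (N : Matrix (Fin b) (Fin d) ℝ) (x : Vec d) :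
    act (M * N) x = act M (act N x) := by
  simp [act, Matrix.toLpLin_apply, Matrix.mulVec_mulVec]

theorem act_add_matrix (M N : Matrix (Fin a) (Fin b) ℝ) (x : Vec b) :
    act (M + N) x = act M x + act N x := by
  simp [act]

theorem act_sub_matrix (M N : Matrix (Fin a) (Fin b) ℝ) (x : Vec b) :
    act (M - N) x = act M x - act N x := by
  simp [act]

theorem act_neg_matrix (M : Matrix (Fin a) (Fin b) ℝ) (x : Vec b) :
    act (-M) x = -act M x := by
  simp [act]

theorem act_smul_matrix (c : ℝ) (M : Matrix (Fin a) (Fin b) ℝ) (x : Vec b) :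
    act (c • M) x = c • act M x := by
  simp [act]

theorem act_one (x : Vec a) : act (1 : Matrix (Fin a) (Fin a) ℝ) x = x := by
  simp [act]

theorem act_zero_matrix (x : Vec b) : act (0 : Matrix (Fin a) (Fin b) ℝ) x = 0 := by
  simp [act]

theorem inner_act (M : Matrix (Fin a) (Fin b) ℝ) (x : Vec a) (y : Vec b) :
    inner ℝ x (act M y) = inner ℝ (act Mᵀ x) y := by
  rw [← Matrix.conjTranspose_eq_transpose_of_trivial, act, act,
    Matrix.toEuclideanLin_conjTranspose_eq_adjoint, LinearMap.adjoint_inner_left]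

theorem inner_act_left (M : Matrix (Fin a) (Fin b) ℝ) (x : Vec b) (y : Vec a) :
    inner ℝ (act M x) y = inner ℝ x (act Mᵀ y) := by
  rw [inner_act, Matrix.transpose_transpose]

theorem inner_act_comm {M : Matrix (Fin d) (Fin d) ℝ} (hM : Mᵀ = M) (x y : Vec d) :
    inner ℝ x (act M y) = inner ℝ y (act M x) := by
  rw [inner_act, hM, real_inner_comm]

theorem quad_eq_dotProduct (M : Matrix (Fin d) (Fin d) ℝ) (x : Vec d) :
    quad M x = x.ofLp ⬝ᵥ (M *ᵥ x.ofLp) := by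
  simp [quad, act, EuclideanSpace.inner_eq_star_dotProduct, dotProduct_comm,
    Matrix.toLpLin_apply]

theorem quad_add_matrix (M N : Matrix (Fin d) (Fin d) ℝ) (x : Vec d) :
    quad (M + N) x = quad M x + quad N x := by
  simp only [quad, act_add_matrix, inner_add_right]

theorem quad_sub_matrix (M N : Matrix (Fin d) (Fin d) ℝ) (x : Vec d) :
    quad (M - N) x = quad M x - quad N x := by
  simp only [quad, act_sub_matrix, inner_sub_right]

theorem quad_smul_matrix (c : ℝ) (M : Matrix (Fin d) (Fin d) ℝ) (x : Vec d) :
    quad (c • M) x = c * quad M x := by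
  simp only [quad, act_smul_matrix, real_inner_smul_right]

theorem quad_zero_matrix (x : Vec d) : quad (0 : Matrix (Fin d) (Fin d) ℝ) x = 0 := by
  simp only [quad, act_zero_matrix, inner_zero_right]

theorem quad_zero (M : Matrix (Fin d) (Fin d) ℝ) : quad M 0 = 0 := by
  simp [quad]

theorem quad_conj (M : Matrix (Fin a) (Fin a) ℝ) (N : Matrix (Fin a) (Fin d) ℝ) (x : Vec d) :
    quad (Nᵀ * M * N) x = quad M (act N x) := by
  rw [quad, quad, act_mul, act_mul, inner_act, Matrix.transpose_transpose]

theorem quad_transpose_mul_self (N : Matrix (Fin a) (Fin d) ℝ) (x : Vec d) :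
    quad (Nᵀ * N) x = ‖act N x‖ ^ 2 := by
  rw [quad, act_mul, inner_act, Matrix.transpose_transpose, real_inner_self_eq_norm_sq]

theorem quad_add {M : Matrix (Fin d) (Fin d) ℝ} (hM : Mᵀ = M) (x y : Vec d) :
    quad M (x + y) = quad M x + 2 * inner ℝ x (act M y) + quad M y := by
  simp only [quad, map_add, inner_add_left, inner_add_right]
  rw [inner_act_comm hM y x]; ring

theorem quad_sub {M : Matrix (Fin d) (Fin d) ℝ} (hM : Mᵀ = M) (x y : Vec d) :
    quad M (x - y) = quad M x - 2 * inner ℝ x (act M y) + quad M y := by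
  simp only [quad, map_sub, inner_sub_left, inner_sub_right]
  rw [inner_act_comm hM y x]; ring

theorem quad_smul (M : Matrix (Fin d) (Fin d) ℝ) (c : ℝ) (x : Vec d) :
    quad M (c • x) = c ^ 2 * quad M x := by
  simp only [quad, map_smul, real_inner_smul_left, real_inner_smul_right]; ring

theorem continuous_act (M : Matrix (Fin a) (Fin b) ℝ) : Continuous (act M) :=
  LinearMap.continuous_of_finiteDimensional (Matrix.toEuclideanLin M)

theorem continuous_quad (M : Matrix (Fin d) (Fin d) ℝ) : Continuous (quad M) :=
  continuous_id.inner (continuous_act M)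

theorem transpose_eq_of_posSemidef {M : Matrix (Fin d) (Fin d) ℝ} (hM : M.PosSemidef) :
    Mᵀ = M := by
  rw [← Matrix.conjTranspose_eq_transpose_of_trivial]; exact hM.1

theorem quad_nonneg {M : Matrix (Fin d) (Fin d) ℝ} (hM : M.PosSemidef) (x : Vec d) :
    0 ≤ quad M x := by
  rw [quad_eq_dotProduct]; simpa using hM.dotProduct_mulVec_nonneg x.ofLp

theorem quad_pos {M : Matrix (Fin d) (Fin d) ℝ} (hM : M.PosDef) {x : Vec d} (hx : x ≠ 0) :
    0 < quad M x := by
  rw [quad_eq_dotProduct]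
  have : x.ofLp ≠ 0 := by simpa using hx
  simpa using hM.dotProduct_mulVec_pos this

theorem posSemidef_of_quad_nonneg {M : Matrix (Fin d) (Fin d) ℝ} (hM : Mᵀ = M)
    (h : ∀ x, 0 ≤ quad M x) : M.PosSemidef := by
  refine Matrix.PosSemidef.of_dotProduct_mulVec_nonneg ?_ fun x => ?_
  · rw [Matrix.IsHermitian, Matrix.conjTranspose_eq_transpose_of_trivial, hM]
  · simpa [quad_eq_dotProduct] using h (WithLp.toLp 2 x)

theorem posDef_of_quad_pos {M : Matrix (Fin d) (Fin d) ℝ} (hM : Mᵀ = M)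
    (h : ∀ x, x ≠ 0 → 0 < quad M x) : M.PosDef := by
  refine Matrix.PosDef.of_dotProduct_mulVec_pos ?_ fun x hx => ?_
  · rw [Matrix.IsHermitian, Matrix.conjTranspose_eq_transpose_of_trivial, hM]
  · simpa [quad_eq_dotProduct] using h (WithLp.toLp 2 x) (by simpa using hx)

theorem eq_of_quad_eq {M N : Matrix (Fin d) (Fin d) ℝ} (hM : Mᵀ = M) (hN : Nᵀ = N)
    (h : ∀ x, quad M x = quad N x) : M = N := by
  refine le_antisymm ?_ ?_ <;> rw [Matrix.le_iff] <;>
    refine posSemidef_of_quad_nonneg (by rw [Matrix.transpose_sub, hM, hN]) fun x => ?_ <;>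
    rw [quad_sub_matrix, h, sub_self]

theorem exists_quad_le (M : Matrix (Fin d) (Fin d) ℝ) :
    ∃ b : ℝ, 0 < b ∧ ∀ x, quad M x ≤ b * ‖x‖ ^ 2 := by
  refine ⟨‖(Matrix.toEuclideanLin M).toContinuousLinearMap‖ + 1, by positivity, fun x => ?_⟩
  have h1 := (Matrix.toEuclideanLin M).toContinuousLinearMap.le_opNorm x
  have h2 := real_inner_le_norm x (act M x)
  simp only [LinearMap.coe_toContinuousLinearMap'] at h1
  have h3 := mul_le_mul_of_nonneg_left h1 (norm_nonneg x)
  simp only [quad, act] at *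
  nlinarith [sq_nonneg ‖x‖]

theorem exists_norm_act_sq_le (M : Matrix (Fin a) (Fin b) ℝ) :
    ∃ c : ℝ, 0 < c ∧ ∀ x, ‖act M x‖ ^ 2 ≤ c * ‖x‖ ^ 2 := by
  obtain ⟨c, hc, h⟩ := exists_quad_le (Mᵀ * M)
  exact ⟨c, hc, fun x => by rw [← quad_transpose_mul_self]; exact h x⟩

/-- By homogeneity, the constant is the minimum over the compact unit sphere; this sphere is empty
in dimension zero. -/
theorem exists_le_quad {M : Matrix (Fin d) (Fin d) ℝ} (hM : M.PosDef) :
    ∃ a : ℝ, 0 < a ∧ ∀ x, a * ‖x‖ ^ 2 ≤ quad M x := by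
  rcases (Metric.sphere (0 : Vec d) 1).eq_empty_or_nonempty with he | hne
  · refine ⟨1, one_pos, fun x => ?_⟩
    have hx : x = 0 := by
      by_contra hx
      have : (‖x‖⁻¹ : ℝ) • x ∈ Metric.sphere (0 : Vec d) 1 := by
        simp [norm_smul, hx]
      rw [he] at this
      exact this
    simp [hx, quad_zero]
  · obtain ⟨y, hy, hmin⟩ := (isCompact_sphere (0 : Vec d) 1).exists_isMinOn hne
      (continuous_quad M).continuousOn
    have hy0 : y ≠ 0 := by
      rintro rfl
      simp at hy
    refine ⟨quad M y, quad_pos hM hy0, fun x => ?_⟩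
    rcases eq_or_ne x 0 with rfl | hx
    · simp [quad_zero]
    · have hxn : 0 < ‖x‖ := norm_pos_iff.2 hx
      have h1 : quad M y ≤ quad M ((‖x‖⁻¹ : ℝ) • x) :=
        hmin (by simp [norm_smul, hx])
      rw [quad_smul] at h1
      calc quad M y * ‖x‖ ^ 2 ≤ (‖x‖⁻¹) ^ 2 * quad M x * ‖x‖ ^ 2 := by gcongr
        _ = quad M x := by field_simp

theorem act_pow_succ (M : Matrix (Fin d) (Fin d) ℝ) (k : ℕ) (x : Vec d) :
    act (M ^ (k + 1)) x = act (M ^ k) (act M x) := by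
  rw [pow_succ, act_mul]

end Algebra

/-! ### Schur stability and quadratic Lyapunov functions -/

section Stability

open Filter Topology

/-- By Gelfand's formula `‖a ^ k‖ ^ (1 / k)` tends to the spectral radius, so any `r` between that
radius and `1` eventually bounds `‖a ^ k‖` by `r ^ k`. -/
theorem tendsto_pow_of_spectrum_lt_one {A : Type*} [NormedRing A] [NormedAlgebra ℂ A]
    [CompleteSpace A] (a : A) (h : ∀ z ∈ spectrum ℂ a, ‖z‖ < 1) :
    Tendsto (fun k : ℕ => a ^ k) atTop (𝓝 0) := by
  rcases subsingleton_or_nontrivial A with hA | hA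
  · exact tendsto_const_nhds.congr fun k => Subsingleton.elim (0 : A) (a ^ k)
  have hr : spectralRadius ℂ a < ((1 : NNReal) : ENNReal) :=
    spectrum.spectralRadius_lt_of_forall_lt a fun z hz => by
      have := h z hz
      exact_mod_cast this
  obtain ⟨r, hr0, hr1⟩ := ENNReal.lt_iff_exists_nnreal_btwn.1 hr
  have hr1' : r < 1 := by exact_mod_cast hr1
  have hev := (spectrum.pow_nnnorm_pow_one_div_tendsto_nhds_spectralRadius a).eventually_lt_const hr0
  have hpow : Tendsto (fun k : ℕ => ((r : ℝ)) ^ k) atTop (𝓝 0) :=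
    tendsto_pow_atTop_nhds_zero_of_lt_one r.2 (by exact_mod_cast hr1')
  refine squeeze_zero_norm' ?_ hpow
  filter_upwards [hev, eventually_gt_atTop 0] with k hk hk0
  have hk0' : (0 : ℝ) < k := by exact_mod_cast hk0
  have h1 : (‖a ^ k‖₊ : ENNReal) ≤ (r : ENNReal) ^ k := by
    have := ENNReal.rpow_le_rpow hk.le hk0'.le
    rwa [← ENNReal.rpow_mul, one_div_mul_cancel hk0'.ne', ENNReal.rpow_one,
      ENNReal.rpow_natCast] at this
  have h2 : ‖a ^ k‖₊ ≤ r ^ k := by exact_mod_cast h1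
  exact_mod_cast h2

-- The spectral argument runs over `ℂ`; entrywise real parts bring the limit back to `ℝ`. The norm
-- is only a local tool, since the limit refers to the matrix topology.
attribute [local instance] Matrix.linftyOpNormedRing Matrix.linftyOpNormedAlgebra in
theorem IsSchurStable.tendsto_pow {d : ℕ} {M : Matrix (Fin d) (Fin d) ℝ} (hM : IsSchurStable M) :
    Tendsto (fun k : ℕ => M ^ k) atTop (𝓝 0) := by
  have h := tendsto_pow_of_spectrum_lt_one (M.map (algebraMap ℝ ℂ)) hM
  have hre : Continuous fun N : Matrix (Fin d) (Fin d) ℂ => N.map Complex.re :=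
    Continuous.matrix_map continuous_id Complex.continuous_re
  have h2 := (hre.tendsto 0).comp h
  have hz : (0 : Matrix (Fin d) (Fin d) ℂ).map Complex.re = 0 := by ext; simp
  rw [hz] at h2
  refine h2.congr fun k => ?_
  have hk : (M.map (algebraMap ℝ ℂ)) ^ k = (M ^ k).map (algebraMap ℝ ℂ) :=
    (map_pow (algebraMap ℝ ℂ).mapMatrix M k).symm
  simp only [Function.comp_apply, hk]
  ext i j
  simp

theorem IsSchurStable.exists_norm_pow_le {d : ℕ} {M : Matrix (Fin d) (Fin d) ℝ}
    (hM : IsSchurStable M) :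
    ∃ N : ℕ, 0 < N ∧ ∀ x, ‖act (M ^ N) x‖ ^ 2 ≤ (1 / 2) * ‖x‖ ^ 2 := by
  -- A linear map out of a finite-dimensional space is continuous, so entrywise convergence of `M ^
  -- k` becomes convergence in operator norm.
  let φ : Matrix (Fin d) (Fin d) ℝ →ₗ[ℝ] (Vec d →L[ℝ] Vec d) :=
    (LinearMap.toContinuousLinearMap (𝕜 := ℝ) (E := Vec d) (F' := Vec d)).toLinearMap ∘ₗ
      (Matrix.toEuclideanLin (𝕜 := ℝ) (m := Fin d) (n := Fin d)).toLinearMap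
  have hφ : Continuous φ := LinearMap.continuous_of_finiteDimensional φ
  have h := ((hφ.tendsto 0).comp hM.tendsto_pow).norm
  rw [map_zero, norm_zero] at h
  obtain ⟨N, hN, hN0⟩ := ((h.eventually_lt_const (show (0 : ℝ) < 1 / 2 by norm_num)).and
    (eventually_gt_atTop 0)).exists
  refine ⟨N, hN0, fun x => ?_⟩
  have h1 : ‖act (M ^ N) x‖ ≤ (1 / 2) * ‖x‖ :=
    ((φ (M ^ N)).le_opNorm x).trans (mul_le_mul_of_nonneg_right hN.le (norm_nonneg x))
  have h2 := pow_le_pow_left₀ (norm_nonneg _) h1 2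
  rw [mul_pow] at h2
  nlinarith [sq_nonneg ‖x‖]

/-- `V` is a strict quadratic Lyapunov function for `x⁺ = M x`, with decay rate `r`. -/
structure IsLyapunov {d : ℕ} (V M : Matrix (Fin d) (Fin d) ℝ) (r : ℝ) : Prop where
  posDef : V.PosDef
  pos : 0 < r
  decrease : ∀ x, quad V (act M x) ≤ quad V x - r * ‖x‖ ^ 2

/-- The truncated Gramian `∑_{k<N} (M ^ k)ᵀ M ^ k` telescopes along `M`: its form changes by `‖M ^ N
x‖² - ‖x‖²`, which is at most `-‖x‖² / 2` for suitable `N`. -/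
theorem IsSchurStable.exists_isLyapunov {d : ℕ} {M : Matrix (Fin d) (Fin d) ℝ}
    (hM : IsSchurStable M) : ∃ V r, IsLyapunov V M r := by
  obtain ⟨N, hN0, hN⟩ := hM.exists_norm_pow_le
  have hq : ∀ x, quad (∑ k ∈ Finset.range N, (M ^ k)ᵀ * M ^ k) x
      = ∑ k ∈ Finset.range N, ‖act (M ^ k) x‖ ^ 2 := by
    intro x
    induction Finset.range N using Finset.induction_on with
    | empty => simp [quad_zero_matrix]
    | insert k s hk ih =>
      rw [Finset.sum_insert hk, Finset.sum_insert hk, quad_add_matrix, ih,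
        quad_transpose_mul_self]
  refine ⟨∑ k ∈ Finset.range N, (M ^ k)ᵀ * M ^ k, 1 / 2, posDef_of_quad_pos ?_ ?_, by norm_num, ?_⟩
  · simp [Matrix.transpose_sum, Matrix.transpose_mul]
  · intro x hx
    rw [hq]
    refine Finset.sum_pos' (fun k _ => sq_nonneg _) ⟨0, Finset.mem_range.2 hN0, ?_⟩
    rw [pow_zero, act_one]
    exact pow_pos (norm_pos_iff.2 hx) 2
  · intro x
    rw [hq, hq]
    have h1 := Finset.sum_range_succ' (fun k => ‖act (M ^ k) x‖ ^ 2) N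
    rw [Finset.sum_range_succ] at h1
    simp only [act_pow_succ, pow_zero, act_one] at h1
    linarith [hN x]

theorem IsLyapunov.exists_norm_pow_le {d : ℕ} {V M : Matrix (Fin d) (Fin d) ℝ} {r : ℝ}
    (h : IsLyapunov V M r) : ∃ c ρ : ℝ, 0 < c ∧ 0 < ρ ∧ ρ < 1 ∧
      ∀ k x, ‖act (M ^ k) x‖ ≤ c * ρ ^ k * ‖x‖ := by
  obtain ⟨a, ha, hVa⟩ := exists_le_quad h.posDef
  obtain ⟨b, hb, hVb⟩ := exists_quad_le V
  -- Adding `r` to `b` forces `r / B < 1`, so the contraction factor `σ` is positive.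
  set B := b + r with hB
  have hr := h.pos
  have hBpos : 0 < B := by positivity
  have hVB : ∀ x, quad V x ≤ B * ‖x‖ ^ 2 := fun x => (hVb x).trans (by
    gcongr; linarith)
  set σ := 1 - r / B with hσ
  have hσ1 : σ < 1 := by have : 0 < r / B := by positivity
                         linarith
  have hσ0 : 0 < σ := by
    have : r / B < 1 := (div_lt_one hBpos).2 (by linarith)
    linarith
  have hstep : ∀ x, quad V (act M x) ≤ σ * quad V x := fun x => by
    have h1 := h.decrease x
    have h2 : r / B * quad V x ≤ r * ‖x‖ ^ 2 := by
      calc r / B * quad V x ≤ r / B * (B * ‖x‖ ^ 2) := by gcongr; exact hVB x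
        _ = r * ‖x‖ ^ 2 := by field_simp
    rw [hσ]; linarith
  have hpow : ∀ k x, quad V (act (M ^ k) x) ≤ σ ^ k * quad V x := by
    intro k
    induction k with
    | zero => intro x; simp [act_one]
    | succ k ih =>
      intro x
      rw [act_pow_succ]
      calc _ ≤ σ ^ k * quad V (act M x) := ih _
        _ ≤ σ ^ k * (σ * quad V x) := by gcongr; exact hstep x
        _ = _ := by ring
  refine ⟨√(B / a), √σ, by positivity, by positivity, ?_, fun k x => ?_⟩
  · rw [Real.sqrt_lt' one_pos]; simpa using hσ1
  · refine abs_le_of_sq_le_sq' ?_ (by positivity) |>.2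
    rw [mul_pow, mul_pow, ← pow_mul, mul_comm k 2, pow_mul, Real.sq_sqrt (by positivity),
      Real.sq_sqrt hσ0.le]
    have h1 := (hVa _).trans (hpow k x)
    have h2 : σ ^ k * quad V x ≤ σ ^ k * (B * ‖x‖ ^ 2) := by gcongr; exact hVB x
    have h3 := h1.trans h2
    rw [← le_div_iff₀' ha] at h3
    calc _ ≤ _ := h3
      _ = _ := by ring

theorem IsLyapunov.tendsto_act_pow {d : ℕ} {V M : Matrix (Fin d) (Fin d) ℝ} {r : ℝ}
    (h : IsLyapunov V M r) (x : Vec d) : Tendsto (fun k : ℕ => act (M ^ k) x) atTop (𝓝 0) := by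
  obtain ⟨c, ρ, -, hρ0, hρ1, hb⟩ := h.exists_norm_pow_le
  refine squeeze_zero_norm (fun k => hb k x) ?_
  simpa using ((tendsto_pow_atTop_nhds_zero_of_lt_one hρ0.le hρ1).const_mul c).mul_const ‖x‖

theorem IsLyapunov.eq_zero_of_act_eq {d : ℕ} {V M : Matrix (Fin d) (Fin d) ℝ} {r : ℝ}
    (h : IsLyapunov V M r) {x : Vec d} (hx : act M x = x) : x = 0 := by
  have h1 := h.decrease x
  rw [hx] at h1
  have h2 : ‖x‖ ^ 2 ≤ 0 := by nlinarith [h.pos, sq_nonneg ‖x‖]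
  simpa using le_antisymm h2 (sq_nonneg _)

/-- If `Mᵀ q = q`, then `⟪q, M ^ k q⟫ = ‖q‖²` for all `k`, while `M ^ k q → 0`. -/
theorem IsLyapunov.eq_zero_of_act_transpose_eq {d : ℕ} {V M : Matrix (Fin d) (Fin d) ℝ} {r : ℝ}
    (h : IsLyapunov V M r) {q : Vec d} (hq : act Mᵀ q = q) : q = 0 := by
  have h1 : ∀ k, act (M ^ k)ᵀ q = q := fun k => by
    induction k with
    | zero => simp [act_one]
    | succ k ih => rw [pow_succ, Matrix.transpose_mul, act_mul, ih, hq]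
  have h2 : Tendsto (fun k : ℕ => inner ℝ q (act (M ^ k) q)) atTop (𝓝 (inner ℝ q 0)) :=
    tendsto_const_nhds.inner (h.tendsto_act_pow q)
  simp only [inner_act, h1, inner_zero_right] at h2
  exact inner_self_eq_zero.1 (tendsto_nhds_unique tendsto_const_nhds h2)

end Stability

/-! ### Dissipativity of the deterministic error system -/

section ErrorSystem

theorem quad_sqrt {d : ℕ} {Q : Matrix (Fin d) (Fin d) ℝ} (hQ : Q.PosSemidef) (x : Vec d) :
    quad Q x = ‖act (CFC.sqrt Q) x‖ ^ 2 := by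
  have h0 : (0 : Matrix (Fin d) (Fin d) ℝ) ≤ Q := Matrix.nonneg_iff_posSemidef.2 hQ
  have h1 : (CFC.sqrt Q)ᵀ = CFC.sqrt Q :=
    transpose_eq_of_posSemidef (Matrix.nonneg_iff_posSemidef.1 (CFC.sqrt_nonneg Q))
  rw [← quad_transpose_mul_self, h1, CFC.sqrt_mul_sqrt_self Q h0]

/-- Young's inequality, from expanding `0 ≤ ‖δ y - w‖_V²` and dividing by `δ`. -/
theorem quad_add_le {d : ℕ} {V : Matrix (Fin d) (Fin d) ℝ} (hV : V.PosSemidef) {δ : ℝ} (hδ : 0 < δ)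
    (y w : Vec d) : quad V (y + w) ≤ (1 + δ) * quad V y + (1 + δ⁻¹) * quad V w := by
  have hs := transpose_eq_of_posSemidef hV
  have h1 := quad_nonneg hV (δ • y - w)
  rw [quad_sub hs, quad_smul, real_inner_smul_left] at h1
  rw [quad_add hs]
  have h2 : 0 ≤ δ⁻¹ * (δ ^ 2 * quad V y - 2 * (δ * inner ℝ y (act V w)) + quad V w) := by positivity
  have h3 : δ⁻¹ * (δ ^ 2 * quad V y - 2 * (δ * inner ℝ y (act V w)) + quad V w)
      = δ * quad V y - 2 * inner ℝ y (act V w) + δ⁻¹ * quad V w := by field_simp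
  linarith

/-- A detectable system has a positive definite quadratic storage function for the supply rate
`‖x‖_Q² + ‖u‖_R²`, with strict dissipation in the state. -/
theorem IsDetectable.exists_storage {n l : ℕ} {A : Matrix (Fin n) (Fin n) ℝ}
    (B : Matrix (Fin n) (Fin l) ℝ) {Q : Matrix (Fin n) (Fin n) ℝ} {R : Matrix (Fin l) (Fin l) ℝ}
    (hQ : Q.PosSemidef) (hR : R.PosDef) (hdet : IsDetectable A (CFC.sqrt Q)) :
    ∃ (S : Matrix (Fin n) (Fin n) ℝ) (r : ℝ), S.PosDef ∧ 0 < r ∧ ∀ x u,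
      r * ‖x‖ ^ 2 ≤ quad Q x + quad R u + quad S x - quad S (act A x + act B u) := by
  obtain ⟨L, hL⟩ := hdet
  obtain ⟨V, r, hV⟩ := hL.exists_isLyapunov
  have hr := hV.pos
  have hVs := hV.posDef.posSemidef
  obtain ⟨b, hb, hVb⟩ := exists_quad_le V
  obtain ⟨cB, hcB, hB⟩ := exists_norm_act_sq_le B
  obtain ⟨cL, hcL, hLb⟩ := exists_norm_act_sq_le L
  obtain ⟨a, ha, hRa⟩ := exists_le_quad hR
  -- With this `δ`, Young's inequality costs `δ b ‖x‖² = (r / 2) ‖x‖²`, half of the Lyapunov decay.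
  -- The constant `m` collects the price of the remainder in units of the supply rate.
  set δ := r / (2 * b) with hδdef
  have hδ : 0 < δ := by positivity
  set m := (1 + δ⁻¹) * (2 * b) * (cB / a + cL) with hm
  have hm0 : 0 < m := by positivity
  have key : ∀ x u, quad V (act A x + act B u) ≤
      quad V x - r / 2 * ‖x‖ ^ 2 + m * (quad Q x + quad R u) := by
    intro x u
    set C := CFC.sqrt Q with hC
    have hQx : quad Q x = ‖act C x‖ ^ 2 := quad_sqrt hQ x
    -- Output injection: the remainder `B u - L C x` is controlled by `‖u‖_R²` and `‖C x‖² =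
    -- ‖x‖_Q²`.
    have hsplit : act A x + act B u = act (A + L * C) x + (act B u - act L (act C x)) := by
      rw [act_add_matrix, act_mul]; abel
    rw [hsplit]
    refine (quad_add_le hVs hδ _ _).trans ?_
    have h1 := hV.decrease x
    have h2 : δ * quad V (act (A + L * C) x) ≤ r / 2 * ‖x‖ ^ 2 := by
      have : quad V (act (A + L * C) x) ≤ b * ‖x‖ ^ 2 := by
        have := hVb x
        nlinarith [sq_nonneg ‖x‖]
      calc δ * quad V (act (A + L * C) x) ≤ δ * (b * ‖x‖ ^ 2) := by gcongr
        _ = r / 2 * ‖x‖ ^ 2 := by rw [hδdef]; field_simp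
    have h3 : ‖act B u - act L (act C x)‖ ^ 2 ≤
        2 * (cB * ‖u‖ ^ 2 + cL * ‖act C x‖ ^ 2) := by
      have e1 := parallelogram_law_with_norm ℝ (act B u) (act L (act C x))
      have e2 := hB u
      have e3 := hLb (act C x)
      nlinarith [sq_nonneg ‖act B u + act L (act C x)‖]
    have h4 : cB * ‖u‖ ^ 2 ≤ cB / a * quad R u := by
      calc cB * ‖u‖ ^ 2 = cB / a * (a * ‖u‖ ^ 2) := by field_simp
        _ ≤ _ := by gcongr; exact hRa u
    have hRu := quad_nonneg hR.posSemidef u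
    have h5 : cB * ‖u‖ ^ 2 + cL * ‖act C x‖ ^ 2 ≤ (cB / a + cL) * (quad Q x + quad R u) := by
      rw [hQx]
      have : 0 ≤ cB / a * ‖act C x‖ ^ 2 := by positivity
      have : 0 ≤ cL * quad R u := by positivity
      linarith
    have h6 : quad V (act B u - act L (act C x)) ≤
        b * (2 * ((cB / a + cL) * (quad Q x + quad R u))) :=
      (hVb _).trans (by gcongr; linarith)
    have h7 : (1 + δ⁻¹) * quad V (act B u - act L (act C x)) ≤ m * (quad Q x + quad R u) := by
      calc _ ≤ (1 + δ⁻¹) * (b * (2 * ((cB / a + cL) * (quad Q x + quad R u)))) := by gcongr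
        _ = _ := by rw [hm]; ring
    linarith
  refine ⟨m⁻¹ • V, m⁻¹ * (r / 2), hV.posDef.smul (by positivity), by positivity, fun x u => ?_⟩
  rw [quad_smul_matrix, quad_smul_matrix]
  have h1 := mul_le_mul_of_nonneg_left (key x u) (by positivity : 0 ≤ m⁻¹)
  have h2 : m⁻¹ * (m * (quad Q x + quad R u)) = quad Q x + quad R u := by field_simp
  rw [mul_add, mul_sub, h2] at h1
  linarith

/-- The optimality system of the steady-state problem of minimizing
`‖x‖_Q² + ‖u‖_R² + sᵀ x + vᵀ u` subject to `(1 - A) x = B u` is solvable. -/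
theorem exists_optimal_steadyState {n l : ℕ} {A : Matrix (Fin n) (Fin n) ℝ}
    {B : Matrix (Fin n) (Fin l) ℝ} {Q S : Matrix (Fin n) (Fin n) ℝ}
    {R : Matrix (Fin l) (Fin l) ℝ} {r : ℝ} (hAB : IsStabilizable A B)
    (hQ : Q.PosSemidef) (hR : R.PosDef) (hr : 0 < r)
    (hS : ∀ x u, r * ‖x‖ ^ 2 ≤ quad Q x + quad R u + quad S x - quad S (act A x + act B u))
    (s : Vec n) (v : Vec l) :
    ∃ (x : Vec n) (u : Vec l) (q : Vec n),
      (2 : ℝ) • act Q x + s + act (1 - A)ᵀ q = 0 ∧ (2 : ℝ) • act R u + v - act Bᵀ q = 0 ∧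
      act (1 - A) x - act B u = 0 := by
  -- The linear part of the optimality system, with multiplier `q`. Domain and codomain agree, so
  -- injectivity suffices.
  let φ : (Vec n × Vec l × Vec n) →ₗ[ℝ] (Vec n × Vec l × Vec n) :=
    { toFun := fun p => ((2 : ℝ) • act Q p.1 + act (1 - A)ᵀ p.2.2,
        (2 : ℝ) • act R p.2.1 - act Bᵀ p.2.2, act (1 - A) p.1 - act B p.2.1)
      map_add' := fun p p' => by
        ext1
        · simp only [Prod.fst_add, Prod.snd_add, map_add, smul_add]; abel
        · ext1 <;> simp only [Prod.fst_add, Prod.snd_add, map_add, smul_add] <;> abel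
      map_smul' := fun c p => by
        ext1
        · simp only [Prod.smul_fst, Prod.smul_snd, map_smul, smul_add, smul_comm c (2 : ℝ),
            RingHom.id_apply]
        · ext1 <;> simp only [Prod.smul_fst, Prod.smul_snd, map_smul, smul_sub,
            smul_comm c (2 : ℝ), RingHom.id_apply] }
  have hinj : Function.Injective φ := by
    rw [← LinearMap.ker_eq_bot, LinearMap.ker_eq_bot']
    rintro ⟨x, u, q⟩ h
    have h1 : (2 : ℝ) • act Q x + act (1 - A)ᵀ q = 0 := congrArg Prod.fst h
    have h2 : (2 : ℝ) • act R u - act Bᵀ q = 0 := congrArg (fun p => p.2.1) h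
    have h3 : act (1 - A) x - act B u = 0 := congrArg (fun p => p.2.2) h
    -- Testing the homogeneous equations with `x` and `u` eliminates the multiplier and leaves
    -- `‖x‖_Q² + ‖u‖_R² = 0`.
    have e1 : 2 * quad Q x + inner ℝ q (act (1 - A) x) = 0 := by
      have := congrArg (inner ℝ x) h1
      rw [inner_add_right, real_inner_smul_right, inner_zero_right, ← inner_act_left,
        real_inner_comm _ (act (1 - A) x)] at this
      exact this
    have e2 : 2 * quad R u - inner ℝ q (act B u) = 0 := by
      have := congrArg (inner ℝ u) h2
      rw [inner_sub_right, real_inner_smul_right, inner_zero_right, ← inner_act_left,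
        real_inner_comm _ (act B u)] at this
      exact this
    have e3 : inner ℝ q (act (1 - A) x) - inner ℝ q (act B u) = 0 := by
      rw [← inner_sub_right, h3, inner_zero_right]
    have hQx := quad_nonneg hQ x
    have hRu := quad_nonneg hR.posSemidef u
    have hu : u = 0 := by
      by_contra hu
      have := quad_pos hR hu
      linarith
    have hfix : act A x + act B u = x := by
      rw [act_sub_matrix, act_one] at h3
      rw [sub_sub, sub_eq_zero] at h3
      exact h3.symm
    -- At a fixed point the two storage terms cancel, so strict dissipation bounds `r ‖x‖²` by a
    -- vanishing supply rate.
    have hx : x = 0 := by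
      have := hS x u
      rw [hfix] at this
      have h0 : ‖x‖ ^ 2 ≤ 0 := by nlinarith [sq_nonneg ‖x‖]
      simpa using le_antisymm h0 (sq_nonneg _)
    subst hu hx
    simp only [map_zero, smul_zero, zero_add, zero_sub, neg_eq_zero] at h1 h2
    obtain ⟨F, hF⟩ := hAB
    obtain ⟨V, r', hV⟩ := hF.exists_isLyapunov
    -- Here `Aᵀ q = q` and `Bᵀ q = 0`, so `q` is fixed by the transpose of the stable matrix `A + B
    -- F`.
    have hq : q = 0 := by
      refine hV.eq_zero_of_act_transpose_eq ?_
      rw [Matrix.transpose_sub, Matrix.transpose_one, act_sub_matrix, act_one, sub_eq_zero] at h1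
      rw [Matrix.transpose_add, Matrix.transpose_mul, act_add_matrix, act_mul, h2, ← h1]
      simp only [map_zero, add_zero]
    subst hq
    rfl
  obtain ⟨⟨x, u, q⟩, h⟩ := (LinearMap.injective_iff_surjective.1 hinj) (-s, -v, 0)
  have h1 : (2 : ℝ) • act Q x + act (1 - A)ᵀ q = -s := congrArg Prod.fst h
  have h2 : (2 : ℝ) • act R u - act Bᵀ q = -v := congrArg (fun p => p.2.1) h
  have h3 : act (1 - A) x - act B u = 0 := congrArg (fun p => p.2.2) h
  refine ⟨x, u, q, ?_, ?_, h3⟩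
  · rw [add_right_comm, h1, neg_add_cancel]
  · rw [add_sub_right_comm, h2, neg_add_cancel]

/-- The part of the stage cost that does not involve covariances, at a deterministic point. -/
noncomputable def Cost.point {n l : ℕ} (C : Cost n l) (x : Vec n) (u : Vec l) : ℝ :=
  quad C.Q₁ x + quad C.R₁ u + inner ℝ C.s x + inner ℝ C.v u + C.c

/-- The Lagrangian is quadratic and stationary at `(xt, ut)`, so its Taylor expansion there is exact
and has no linear term. -/
theorem Cost.point_sub_point {n l : ℕ} {C : Cost n l} {A : Matrix (Fin n) (Fin n) ℝ}
    {B : Matrix (Fin n) (Fin l) ℝ} (hQ : C.Q₁.PosSemidef) (hR : C.R₁.PosDef)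
    {xt q : Vec n} {ut : Vec l} (h1 : (2 : ℝ) • act C.Q₁ xt + C.s + act (1 - A)ᵀ q = 0)
    (h2 : (2 : ℝ) • act C.R₁ ut + C.v - act Bᵀ q = 0) (h3 : act (1 - A) xt - act B ut = 0)
    (x : Vec n) (u : Vec l) :
    C.point x u - C.point xt ut + inner ℝ q (x - (act A x + act B u))
      = quad C.Q₁ (x - xt) + quad C.R₁ (u - ut) := by
  have e1 := congrArg (inner ℝ (x - xt)) h1
  have e2 := congrArg (inner ℝ (u - ut)) h2
  have e3 := congrArg (inner ℝ q) h3
  simp only [inner_add_right, inner_sub_right, inner_sub_left, real_inner_smul_right,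
    inner_zero_right, ← inner_act_left, act_sub_matrix, act_one] at e1 e2 e3
  rw [quad_sub (transpose_eq_of_posSemidef hQ), quad_sub (transpose_eq_of_posSemidef hR.posSemidef)]
  simp only [Cost.point, inner_add_right, inner_sub_right]
  simp only [quad] at *
  rw [real_inner_comm x C.s, real_inner_comm xt C.s, real_inner_comm u C.v, real_inner_comm ut C.v,
    real_inner_comm x q, real_inner_comm (act A x) q, real_inner_comm (act B u) q]
  rw [real_inner_comm xt q, real_inner_comm (act A xt) q, real_inner_comm (act B ut) q] at e3
  linarith

theorem Cost.exists_point_dissipation {n l : ℕ} (C : Cost n l) {A : Matrix (Fin n) (Fin n) ℝ}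
    {B : Matrix (Fin n) (Fin l) ℝ} {S : Matrix (Fin n) (Fin n) ℝ} {r : ℝ} (hAB : IsStabilizable A B)
    (hQ : C.Q₁.PosSemidef) (hR : C.R₁.PosDef) (hSpos : S.PosDef) (hr : 0 < r)
    (hS : ∀ x u, r * ‖x‖ ^ 2 ≤ quad C.Q₁ x + quad C.R₁ u + quad S x - quad S (act A x + act B u)) :
    ∃ (q xt : Vec n) (ut : Vec l), act (1 - A) xt - act B ut = 0 ∧ ∀ x u,
      r * ‖x - xt‖ ^ 2 ≤ C.point x u - C.point xt ut + (quad S x + inner ℝ q x)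
        - (quad S (act A x + act B u) + inner ℝ q (act A x + act B u)) := by
  obtain ⟨xt, ut, q, h1, h2, h3⟩ := exists_optimal_steadyState hAB hQ hR hr hS C.s C.v
  -- The storage `‖x - xt‖_S²` equals `‖x‖_S² - 2 (S xt)ᵀ x` up to a constant, which cancels between
  -- a state and its successor.
  refine ⟨q - (2 : ℝ) • act S xt, xt, ut, h3, fun x u => ?_⟩
  have hSt := transpose_eq_of_posSemidef hSpos.posSemidef
  have e1 := Cost.point_sub_point hQ hR h1 h2 h3 x u
  have e2 := hS (x - xt) (u - ut)
  have e3 : act A (x - xt) + act B (u - ut) = (act A x + act B u) - xt := by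
    rw [act_sub_matrix, act_one, sub_sub, sub_eq_zero] at h3
    conv_rhs => rw [h3]
    simp only [map_sub]; abel
  rw [e3, quad_sub hSt, quad_sub hSt (act A x + act B u)] at e2
  rw [inner_sub_right] at e1
  simp only [inner_sub_left, real_inner_smul_left]
  rw [real_inner_comm x (act S xt), real_inner_comm (act A x + act B u) (act S xt)]
  linarith

end ErrorSystem

/-! ### Existence and uniqueness for the Riccati equation -/

section Riccati

open Filter Topology

variable {n l : ℕ} (A : Matrix (Fin n) (Fin n) ℝ) (B : Matrix (Fin n) (Fin l) ℝ)
  (Q : Matrix (Fin n) (Fin n) ℝ) (R : Matrix (Fin l) (Fin l) ℝ)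

/-- The right-hand side of the discrete-time algebraic Riccati equation. -/
noncomputable def riccatiMap (P : Matrix (Fin n) (Fin n) ℝ) : Matrix (Fin n) (Fin n) ℝ :=
  Aᵀ * P * A + Q - Aᵀ * P * B * (R + Bᵀ * P * B)⁻¹ * Bᵀ * P * A

/-- The optimal feedback gain for the terminal weight `P`. -/
noncomputable def riccatiGain (P : Matrix (Fin n) (Fin n) ℝ) : Matrix (Fin l) (Fin n) ℝ :=
  -((R + Bᵀ * P * B)⁻¹ * Bᵀ * P * A)

variable {A B Q R} {P P' : Matrix (Fin n) (Fin n) ℝ}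

theorem posDef_add_conj (hR : R.PosDef) (hP : P.PosSemidef) : (R + Bᵀ * P * B).PosDef := by
  rw [← Matrix.conjTranspose_eq_transpose_of_trivial]
  exact hR.add_posSemidef (hP.conjTranspose_mul_mul_same B)

theorem mul_riccatiGain (hR : R.PosDef) (hP : P.PosSemidef) :
    (R + Bᵀ * P * B) * riccatiGain A B R P = -(Bᵀ * P * A) := by
  have hu : IsUnit (R + Bᵀ * P * B).det :=
    (Matrix.isUnit_iff_isUnit_det _).1 (posDef_add_conj hR hP).isUnit
  rw [riccatiGain, Matrix.mul_neg, Matrix.mul_assoc _ _ P, Matrix.mul_assoc _ _ A,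
    Matrix.mul_nonsing_inv_cancel_left _ _ hu, Matrix.mul_assoc]

theorem riccatiMap_eq (P : Matrix (Fin n) (Fin n) ℝ) :
    riccatiMap A B Q R P = Aᵀ * P * A + Q + Aᵀ * P * B * riccatiGain A B R P := by
  rw [riccatiMap, riccatiGain, Matrix.mul_neg, ← sub_eq_add_neg]
  simp only [Matrix.mul_assoc]

theorem riccatiMap_transpose (hQ : Q.PosSemidef) (hR : R.PosDef) (hP : P.PosSemidef) :
    (riccatiMap A B Q R P)ᵀ = riccatiMap A B Q R P := by
  have hPt := transpose_eq_of_posSemidef hP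
  have hQt := transpose_eq_of_posSemidef hQ
  have hGt := transpose_eq_of_posSemidef (posDef_add_conj (B := B) hR hP).posSemidef
  simp only [riccatiMap, Matrix.transpose_sub, Matrix.transpose_add, Matrix.transpose_mul,
    Matrix.transpose_nonsing_inv, Matrix.transpose_transpose, hPt, hQt]
  simp only [Matrix.transpose_add, Matrix.transpose_mul, Matrix.transpose_transpose, hPt] at hGt
  rw [hGt]
  simp only [Matrix.mul_assoc]

/-- Completion of the square in the Bellman equation. -/
theorem bellman (hR : R.PosDef) (hP : P.PosSemidef) (x : Vec n) (u : Vec l) :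
    quad Q x + quad R u + quad P (act A x + act B u)
      = quad (riccatiMap A B Q R P) x
        + quad (R + Bᵀ * P * B) (u - act (riccatiGain A B R P) x) := by
  have hPt := transpose_eq_of_posSemidef hP
  have hGt := transpose_eq_of_posSemidef (posDef_add_conj (B := B) hR hP).posSemidef
  set K := riccatiGain A B R P with hK
  have hGK : ∀ w, inner ℝ w (act (R + Bᵀ * P * B) (act K x)) = -inner ℝ (act A x) (act P (act B w)) := by
    intro w
    rw [← act_mul, mul_riccatiGain hR hP, act_neg_matrix, act_mul, act_mul, inner_neg_right,
      ← inner_act_left, inner_act_comm hPt]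
  have e1 : quad (Aᵀ * P * B * K) x = inner ℝ (act A x) (act P (act B (act K x))) := by
    rw [quad, act_mul, act_mul, act_mul, ← inner_act_left]
  have e2 : quad (R + Bᵀ * P * B) (act K x) = -inner ℝ (act A x) (act P (act B (act K x))) :=
    hGK (act K x)
  rw [riccatiMap_eq, quad_sub hGt, hGK, e2, quad_add hPt, quad_add_matrix, quad_add_matrix, e1,
    quad_conj, quad_add_matrix R, quad_conj]
  ring

theorem quad_riccatiMap (hR : R.PosDef) (hP : P.PosSemidef) (x : Vec n) :
    quad (riccatiMap A B Q R P) x = quad Q x + quad R (act (riccatiGain A B R P) x)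
      + quad P (act (A + B * riccatiGain A B R P) x) := by
  rw [act_add_matrix, act_mul, bellman hR hP, sub_self, quad_zero, add_zero]

theorem quad_riccatiMap_le (hR : R.PosDef) (hP : P.PosSemidef) (x : Vec n) (u : Vec l) :
    quad (riccatiMap A B Q R P) x ≤ quad Q x + quad R u + quad P (act A x + act B u) := by
  rw [bellman hR hP]
  linarith [quad_nonneg (posDef_add_conj (B := B) hR hP).posSemidef
    (u - act (riccatiGain A B R P) x)]

theorem riccatiMap_posSemidef (hQ : Q.PosSemidef) (hR : R.PosDef) (hP : P.PosSemidef) :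
    (riccatiMap A B Q R P).PosSemidef := by
  refine posSemidef_of_quad_nonneg (riccatiMap_transpose hQ hR hP) fun x => ?_
  rw [quad_riccatiMap hR hP]
  linarith [quad_nonneg hQ x, quad_nonneg hR.posSemidef (act (riccatiGain A B R P) x),
    quad_nonneg hP (act (A + B * riccatiGain A B R P) x)]

/-- The optimal gain for `P'` is a feasible, possibly suboptimal, choice for `P`. -/
theorem quad_riccatiMap_mono (hR : R.PosDef) (hP : P.PosSemidef) (hP' : P'.PosSemidef)
    (h : ∀ x, quad P x ≤ quad P' x) (x : Vec n) :
    quad (riccatiMap A B Q R P) x ≤ quad (riccatiMap A B Q R P') x := by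
  rw [quad_riccatiMap hR hP']
  refine (quad_riccatiMap_le hR hP x (act (riccatiGain A B R P') x)).trans ?_
  rw [act_add_matrix, act_mul]
  linarith [h (act A x + act B (act (riccatiGain A B R P') x))]

theorem continuousAt_riccatiMap (hR : R.PosDef) (hP : P.PosSemidef) :
    ContinuousAt (riccatiMap A B Q R) P := by
  have hdet : (R + Bᵀ * P * B).det ≠ 0 := (posDef_add_conj (B := B) hR hP).det_pos.ne'
  have hinv : ContinuousAt (fun P : Matrix (Fin n) (Fin n) ℝ => (R + Bᵀ * P * B)⁻¹) P := by
    simp only [Matrix.inv_def, Ring.inverse_eq_inv']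
    have h1 : Continuous fun P : Matrix (Fin n) (Fin n) ℝ => (R + Bᵀ * P * B).det := by fun_prop
    have h2 : Continuous fun P : Matrix (Fin n) (Fin n) ℝ => (R + Bᵀ * P * B).adjugate := by
      fun_prop
    exact (h1.continuousAt.inv₀ hdet).smul h2.continuousAt
  unfold riccatiMap
  fun_prop

theorem continuous_quad_matrix {d : ℕ} (x : Vec d) :
    Continuous fun M : Matrix (Fin d) (Fin d) ℝ => quad M x := by
  simp only [quad_eq_dotProduct]
  fun_prop

/-- Each quadratic form converges as a bounded monotone sequence, and polarization recovers the
matrix entries. -/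
theorem exists_tendsto_of_quad_monotone {d : ℕ} {p : ℕ → Matrix (Fin d) (Fin d) ℝ}
    {T : Matrix (Fin d) (Fin d) ℝ} (hp : ∀ k, (p k).PosSemidef)
    (hmono : ∀ k x, quad (p k) x ≤ quad (p (k + 1)) x) (hT : ∀ k x, quad (p k) x ≤ quad T x) :
    ∃ P : Matrix (Fin d) (Fin d) ℝ, P.PosSemidef ∧ Tendsto p atTop (𝓝 P) := by
  have hq : ∀ x, ∃ y, Tendsto (fun k => quad (p k) x) atTop (𝓝 y) := fun x =>
    ⟨_, tendsto_atTop_ciSup (monotone_nat_of_le_succ fun k => hmono k x)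
      ⟨quad T x, by rintro _ ⟨k, rfl⟩; exact hT k x⟩⟩
  have hentry : ∀ (M : Matrix (Fin d) (Fin d) ℝ), Mᵀ = M → ∀ i j, M i j =
      (quad M (EuclideanSpace.single i 1 + EuclideanSpace.single j 1)
        - quad M (EuclideanSpace.single i 1) - quad M (EuclideanSpace.single j 1)) / 2 := by
    intro M hM i j
    rw [quad_add hM]
    have : inner ℝ (EuclideanSpace.single i (1 : ℝ)) (act M (EuclideanSpace.single j 1)) = M i j := by
      rw [EuclideanSpace.inner_single_left]
      simp [act, Matrix.toLpLin_apply]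
    rw [this]; ring
  have hlim : ∀ i j, ∃ y, Tendsto (fun k => p k i j) atTop (𝓝 y) := by
    intro i j
    obtain ⟨y1, h1⟩ := hq (EuclideanSpace.single i 1 + EuclideanSpace.single j 1)
    obtain ⟨y2, h2⟩ := hq (EuclideanSpace.single i 1)
    obtain ⟨y3, h3⟩ := hq (EuclideanSpace.single j 1)
    exact ⟨_, (((h1.sub h2).sub h3).div_const 2).congr fun k =>
      (hentry (p k) (transpose_eq_of_posSemidef (hp k)) i j).symm⟩
  choose P hP using hlim
  have hPt : Tendsto p atTop (𝓝 (Matrix.of P)) :=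
    tendsto_pi_nhds.2 fun i => tendsto_pi_nhds.2 fun j => hP i j
  refine ⟨Matrix.of P, posSemidef_of_quad_nonneg ?_ fun x => ?_, hPt⟩
  · have h1 : Tendsto (fun k => (p k)ᵀ) atTop (𝓝 (Matrix.of P)ᵀ) :=
      (continuous_id.matrix_transpose.tendsto (Matrix.of P)).comp hPt
    exact tendsto_nhds_unique (h1.congr fun k => transpose_eq_of_posSemidef (hp k)) hPt
  · exact ge_of_tendsto' (((continuous_quad_matrix x).tendsto _).comp hPt)
      fun k => quad_nonneg (hp k) x

theorem IsStabilizable.exists_riccati_upperBound (hAB : IsStabilizable A B) :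
    ∃ (T : Matrix (Fin n) (Fin n) ℝ) (F : Matrix (Fin l) (Fin n) ℝ), T.PosSemidef ∧ ∀ x,
      quad Q x + quad R (act F x) + quad T (act A x + act B (act F x)) ≤ quad T x := by
  obtain ⟨F, hF⟩ := hAB
  obtain ⟨V, r, hV⟩ := hF.exists_isLyapunov
  have hr := hV.pos
  obtain ⟨b, hb, hQb⟩ := exists_quad_le (Q + Fᵀ * R * F)
  -- Scaling by `b / r` turns the Lyapunov decay `r ‖x‖²` into `b ‖x‖²`, which dominates the running
  -- cost under the feedback `F`.
  refine ⟨(b / r) • V, F, hV.posDef.posSemidef.smul (by positivity), fun x => ?_⟩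
  have h1 := hQb x
  rw [quad_add_matrix, quad_conj] at h1
  have h2 := hV.decrease x
  rw [act_add_matrix, act_mul] at h2
  rw [quad_smul_matrix, quad_smul_matrix]
  have h3 := mul_le_mul_of_nonneg_left h2 (by positivity : 0 ≤ b / r)
  have h4 : b / r * (r * ‖x‖ ^ 2) = b * ‖x‖ ^ 2 := by field_simp
  rw [mul_sub, h4] at h3
  linarith

/-- Value iteration from `0` increases by monotonicity of the Riccati map and stays below the cost
bound of a stabilizing feedback; its limit is a fixed point by continuity. -/
theorem exists_riccati_solution (hAB : IsStabilizable A B) (hQ : Q.PosSemidef) (hR : R.PosDef) :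
    ∃ P : Matrix (Fin n) (Fin n) ℝ, P.PosSemidef ∧ riccatiMap A B Q R P = P := by
  obtain ⟨T, F, hT, hTF⟩ := hAB.exists_riccati_upperBound (Q := Q) (R := R)
  set p : ℕ → Matrix (Fin n) (Fin n) ℝ := fun k => (riccatiMap A B Q R)^[k] 0 with hpdef
  have hsucc : ∀ k, p (k + 1) = riccatiMap A B Q R (p k) := fun k =>
    Function.iterate_succ_apply' _ _ _
  have hp : ∀ k, (p k).PosSemidef := by
    intro k
    induction k with
    | zero => exact Matrix.PosSemidef.zero
    | succ k ih => rw [hsucc]; exact riccatiMap_posSemidef hQ hR ih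
  have hmono : ∀ k x, quad (p k) x ≤ quad (p (k + 1)) x := by
    intro k
    induction k with
    | zero => intro x; rw [show p 0 = 0 from rfl, quad_zero_matrix]; exact quad_nonneg (hp 1) x
    | succ k ih =>
      rw [hsucc k, hsucc (k + 1)]
      exact quad_riccatiMap_mono hR (hp k) (hp (k + 1)) ih
  have hle : ∀ k x, quad (p k) x ≤ quad T x := by
    intro k
    induction k with
    | zero => intro x; rw [show p 0 = 0 from rfl, quad_zero_matrix]; exact quad_nonneg hT x
    | succ k ih =>
      intro x
      rw [hsucc]
      refine (quad_riccatiMap_le hR (hp k) x (act F x)).trans ((hTF x).trans' ?_)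
      linarith [ih (act A x + act B (act F x))]
  obtain ⟨P, hP, hlim⟩ := exists_tendsto_of_quad_monotone hp hmono hle
  refine ⟨P, hP, ?_⟩
  have h1 : Tendsto (fun k => p (k + 1)) atTop (𝓝 (riccatiMap A B Q R P)) := by
    simp only [hsucc]
    exact (continuousAt_riccatiMap hR hP).tendsto.comp hlim
  exact tendsto_nhds_unique h1 (hlim.comp (tendsto_add_atTop_nat 1))

/-- The closed loop of a positive semidefinite Riccati solution is stable when the system has a
strict storage function. -/
theorem isLyapunov_closedLoop {S : Matrix (Fin n) (Fin n) ℝ} {r : ℝ} (hR : R.PosDef)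
    (hSpos : S.PosDef) (hr : 0 < r)
    (hS : ∀ x u, r * ‖x‖ ^ 2 ≤ quad Q x + quad R u + quad S x - quad S (act A x + act B u))
    (hP : P.PosSemidef) (hPe : riccatiMap A B Q R P = P) :
    IsLyapunov (P + S) (A + B * riccatiGain A B R P) r := by
  refine ⟨add_comm S P ▸ hSpos.add_posSemidef hP, hr, fun x => ?_⟩
  have h1 := quad_riccatiMap (A := A) (B := B) (Q := Q) hR hP x
  rw [hPe] at h1
  have h2 := hS x (act (riccatiGain A B R P) x)
  rw [← act_mul, ← act_add_matrix] at h2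
  rw [quad_add_matrix, quad_add_matrix]
  linarith

/-- Along the closed loop of `P`, Bellman's relation is an equality for `P` and an inequality for
`P'`. So the form of `P' - P` is nondecreasing along trajectories, which tend to `0`. -/
theorem quad_le_of_riccati_solution {V : Matrix (Fin n) (Fin n) ℝ} {r : ℝ} (hR : R.PosDef)
    (hP : P.PosSemidef) (hPe : riccatiMap A B Q R P = P)
    (hP' : P'.PosSemidef) (hPe' : riccatiMap A B Q R P' = P')
    (hV : IsLyapunov V (A + B * riccatiGain A B R P) r) (x : Vec n) : quad P' x ≤ quad P x := by
  set M := A + B * riccatiGain A B R P with hM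
  have hstep : ∀ x, quad (P' - P) x ≤ quad (P' - P) (act M x) := by
    intro x
    have h1 := quad_riccatiMap (A := A) (B := B) (Q := Q) hR hP x
    have h2 := quad_riccatiMap_le (A := A) (B := B) (Q := Q) hR hP' x (act (riccatiGain A B R P) x)
    rw [← act_mul, ← act_add_matrix] at h2
    rw [hPe] at h1
    rw [hPe'] at h2
    rw [quad_sub_matrix, quad_sub_matrix]
    linarith
  have hpow : ∀ k x, quad (P' - P) x ≤ quad (P' - P) (act (M ^ k) x) := by
    intro k
    induction k with
    | zero => intro x; simp [act_one]
    | succ k ih => intro x; rw [act_pow_succ]; exact (hstep x).trans (ih _)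
  have hlim := ((continuous_quad (P' - P)).tendsto 0).comp (hV.tendsto_act_pow x)
  have h0 := ge_of_tendsto' hlim fun k => hpow k x
  rw [quad_zero, quad_sub_matrix] at h0
  linarith

theorem riccati_solution_unique {S : Matrix (Fin n) (Fin n) ℝ} {r : ℝ} (hR : R.PosDef)
    (hSpos : S.PosDef) (hr : 0 < r)
    (hS : ∀ x u, r * ‖x‖ ^ 2 ≤ quad Q x + quad R u + quad S x - quad S (act A x + act B u))
    (hP : P.PosSemidef) (hPe : riccatiMap A B Q R P = P)
    (hP' : P'.PosSemidef) (hPe' : riccatiMap A B Q R P' = P') : P' = P :=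
  eq_of_quad_eq (transpose_eq_of_posSemidef hP') (transpose_eq_of_posSemidef hP) fun x =>
    le_antisymm
      (quad_le_of_riccati_solution hR hP hPe hP' hPe'
        (isLyapunov_closedLoop hR hSpos hr hS hP hPe) x)
      (quad_le_of_riccati_solution hR hP' hPe' hP hPe
        (isLyapunov_closedLoop hR hSpos hr hS hP' hPe') x)

end Riccati

/-! ### Invariant laws and independence of the noise -/

section Noise

variable {Ω : Type*} [MeasurableSpace Ω] {μ : Measure Ω}

theorem indepFun_tail {β : Type*} [MeasurableSpace β] {W : ℕ → Ω → β}
    (hmeas : ∀ k, Measurable (W k)) (h : iIndepFun W μ) (k : ℕ) :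
    IndepFun (W k) (fun ω j => W (k + 1 + j) ω) μ := by
  have hdisj : Disjoint ({k} : Set ℕ) {i | k < i} := by simp
  have hind := indep_iSup_of_disjoint (fun i => (hmeas i).comap_le) h.iIndep hdisj
  rw [IndepFun_iff_Indep]
  refine indep_of_indep_of_le_left (indep_of_indep_of_le_right hind ?_) ?_
  · rw [MeasurableSpace.pi, MeasurableSpace.comap_iSup]
    refine iSup_le fun j => ?_
    rw [MeasurableSpace.comap_comp]
    exact le_iSup₂_of_le (k + 1 + j) (show k < k + 1 + j by omega) le_rfl
  · exact le_iSup₂_of_le k rfl le_rfl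

/-- The two hypotheses make the joint law of the triple a threefold product, which can be
reassociated. -/
theorem indepFun_prodMk_left {α β γ : Type*} [MeasurableSpace α] [MeasurableSpace β]
    [MeasurableSpace γ] [IsProbabilityMeasure μ] {X : Ω → α} {Y : Ω → β} {Z : Ω → γ}
    (hX : Measurable X) (hY : Measurable Y) (hZ : Measurable Z)
    (h : IndepFun X (fun ω => (Y ω, Z ω)) μ) (hYZ : IndepFun Y Z μ) :
    IndepFun (fun ω => (X ω, Y ω)) Z μ := by
  have := Measure.isProbabilityMeasure_map (μ := μ) hX.aemeasurable
  have := Measure.isProbabilityMeasure_map (μ := μ) hY.aemeasurable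
  have := Measure.isProbabilityMeasure_map (μ := μ) hZ.aemeasurable
  have hXY : IndepFun X Y μ := h.comp measurable_id measurable_fst
  rw [indepFun_iff_map_prod_eq_prod_map_map (by fun_prop) (by fun_prop),
    hXY.map_prod_eq_prod_map_map (by fun_prop) (by fun_prop)]
  have h1 := h.map_prod_eq_prod_map_map (by fun_prop) (by fun_prop)
  rw [hYZ.map_prod_eq_prod_map_map (by fun_prop) (by fun_prop)] at h1
  have h2 := (measurePreserving_prodAssoc (μ.map X) (μ.map Y) (μ.map Z)).symm.map_eq
  rw [← h2, ← h1, Measure.map_map (by fun_prop) (by fun_prop)]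
  rfl

/-- The affine recursion `Z = M (Z ∘ σ) + g` over a measure preserving map `σ` has a square
integrable solution when `M` is stable. -/
theorem IsLyapunov.exists_memLp_fixedPoint {α : Type*} [MeasurableSpace α] {ν : Measure α}
    {σ : α → α} (hσ : MeasurePreserving σ ν ν) {n : ℕ} {V M : Matrix (Fin n) (Fin n) ℝ} {r : ℝ}
    (h : IsLyapunov V M r) {g : α → Vec n} (hg : MemLp g 2 ν) :
    ∃ Z : α → Vec n, Measurable Z ∧ MemLp Z 2 ν ∧ Z =ᵐ[ν] fun a => act M (Z (σ a)) + g a := by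
  obtain ⟨c, ρ, hc, hρ0, hρ1, hb⟩ := h.exists_norm_pow_le
  let Φ : Matrix (Fin n) (Fin n) ℝ → (Vec n →L[ℝ] Vec n) := fun N =>
    (Matrix.toEuclideanLin N).toContinuousLinearMap
  let S : Lp (Vec n) 2 ν →L[ℝ] Lp (Vec n) 2 ν :=
    (Lp.compMeasurePreservingₗᵢ ℝ σ hσ).toContinuousLinearMap
  have hS : ∀ f : Lp (Vec n) 2 ν, S f =ᵐ[ν] f ∘ σ := fun f =>
    Lp.coeFn_compMeasurePreserving f hσ
  have hSn : ∀ f : Lp (Vec n) 2 ν, ‖S f‖ = ‖f‖ := fun f => Lp.norm_compMeasurePreserving f hσ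
  let T : Lp (Vec n) 2 ν →L[ℝ] Lp (Vec n) 2 ν := ((Φ M).compLpL 2 ν).comp S
  have hT : ∀ f, T f = (Φ M).compLp (S f) := fun f => rfl
  have hcomm : ∀ N (f : Lp (Vec n) 2 ν), S ((Φ N).compLp f) = (Φ N).compLp (S f) := by
    intro N f
    apply Lp.ext
    filter_upwards [hS ((Φ N).compLp f), (Φ N).coeFn_compLp (S f), hS f,
      hσ.quasiMeasurePreserving.ae ((Φ N).coeFn_compLp f)] with a h1 h2 h3 h4
    rw [h1, h2, h3]
    exact h4
  have hmul : ∀ N N' (f : Lp (Vec n) 2 ν),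
      (Φ N).compLp ((Φ N').compLp f) = (Φ (N * N')).compLp f := by
    intro N N' f
    apply Lp.ext
    filter_upwards [(Φ N).coeFn_compLp ((Φ N').compLp f), (Φ N').coeFn_compLp f,
      (Φ (N * N')).coeFn_compLp f] with a h1 h2 h3
    rw [h1, h2, h3]
    exact (act_mul N N' (f a)).symm
  -- `T` itself need not contract. But `T ^ k` is `M ^ k` applied after an isometry, so its norm
  -- decays geometrically and the Neumann series converges.
  have hpow : ∀ k f, ∃ f', ‖f'‖ = ‖f‖ ∧ (T ^ k) f = (Φ (M ^ k)).compLp f' := by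
    intro k f
    induction k with
    | zero =>
      refine ⟨f, rfl, Lp.ext ?_⟩
      filter_upwards [(Φ (M ^ 0)).coeFn_compLp f] with a h1
      rw [h1, pow_zero, pow_zero]
      exact (act_one _).symm
    | succ k ih =>
      obtain ⟨f', hf', he⟩ := ih
      refine ⟨S f', (hSn f').trans hf', ?_⟩
      rw [pow_succ', mul_apply_eq_comp, he, hT, hcomm, hmul, ← pow_succ']
  have hΦ : ∀ k, ‖Φ (M ^ k)‖ ≤ c * ρ ^ k := fun k =>
    ContinuousLinearMap.opNorm_le_bound _ (by positivity) (hb k)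
  have hsum : Summable fun k : ℕ => (T ^ k) (hg.toLp g) := by
    refine Summable.of_norm_bounded
      (((summable_geometric_of_lt_one hρ0.le hρ1).mul_left c).mul_right ‖hg.toLp g‖) fun k => ?_
    obtain ⟨f', hf', he⟩ := hpow k (hg.toLp g)
    rw [he, ← hf']
    exact ((Φ (M ^ k)).norm_compLp_le f').trans
      (mul_le_mul_of_nonneg_right (hΦ k) (norm_nonneg _))
  set Z := ∑' k : ℕ, (T ^ k) (hg.toLp g) with hZ
  have hfix : Z = hg.toLp g + (Φ M).compLp (S Z) := by
    rw [← hT, hZ, T.map_tsum hsum, hsum.tsum_eq_zero_add]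
    simp only [pow_zero, one_apply_eq_self, pow_succ', mul_apply_eq_comp]
  refine ⟨Z, (Lp.stronglyMeasurable Z).measurable, Lp.memLp Z, ?_⟩
  have h0 : (Z : α → Vec n) =ᵐ[ν] ⇑(hg.toLp g + (Φ M).compLp (S Z)) := by
    conv_lhs => rw [hfix]
  filter_upwards [h0, Lp.coeFn_add (hg.toLp g) ((Φ M).compLp (S Z)), hg.coeFn_toLp,
    (Φ M).coeFn_compLp (S Z), hS Z] with a h1 h2 h3 h4 h5
  rw [h1, h2, Pi.add_apply, h3, h4, h5, add_comm]
  rfl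

theorem IsP2.memLp_id {d : ℕ} {ρ : Measure (Vec d)} (h : IsP2 ρ) : MemLp id 2 ρ :=
  (memLp_two_iff_integrable_sq_norm aestronglyMeasurable_id).2 h.integrable_sq

theorem isP2_map {d : ℕ} [IsProbabilityMeasure μ] {X : Ω → Vec d} (hX : MemLp X 2 μ) :
    IsP2 (μ.map X) where
  isProbabilityMeasure := Measure.isProbabilityMeasure_map hX.aestronglyMeasurable.aemeasurable
  integrable_sq := by
    refine (memLp_two_iff_integrable_sq_norm aestronglyMeasurable_id).1
      ((memLp_map_measure_iff aestronglyMeasurable_id hX.aestronglyMeasurable.aemeasurable).2 ?_)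
    exact hX

theorem IsP2.memLp_of_hasLaw {d : ℕ} {ρ : Measure (Vec d)} (h : IsP2 ρ) {X : Ω → Vec d}
    (hX : HasLaw X ρ μ) : MemLp X 2 μ := by
  have h1 := h.memLp_id
  rw [← hX.map_eq, memLp_map_measure_iff aestronglyMeasurable_id hX.aemeasurable] at h1
  exact h1

theorem memLp_act {a b : ℕ} (M : Matrix (Fin a) (Fin b) ℝ) {X : Ω → Vec b} (hX : MemLp X 2 μ) :
    MemLp (fun ω => act M (X ω)) 2 μ :=
  (Matrix.toEuclideanLin M).toContinuousLinearMap.comp_memLp' hX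

theorem integral_act {a b : ℕ} (M : Matrix (Fin a) (Fin b) ℝ) {X : Ω → Vec b}
    (hX : Integrable X μ) : ∫ ω, act M (X ω) ∂μ = act M (∫ ω, X ω ∂μ) :=
  (Matrix.toEuclideanLin M).toContinuousLinearMap.integral_comp_comm hX

theorem measurable_act {a b : ℕ} (M : Matrix (Fin a) (Fin b) ℝ) : Measurable (act M) :=
  (continuous_act M).measurable

/-- A stable affine Markov chain `x⁺ = M (x - c) + E (w - m) + c` driven by independent noise has an
invariant law of finite second moment. -/
theorem IsLyapunov.exists_invariant {n m : ℕ} {V M : Matrix (Fin n) (Fin n) ℝ} {r : ℝ}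
    (h : IsLyapunov V M r) (E : Matrix (Fin n) (Fin m) ℝ) (c : Vec n) (w₀ : Vec m)
    {ρW : Measure (Vec m)} (hρW : IsP2 ρW) :
    ∃ ρ : Measure (Vec n), IsP2 ρ ∧
      (ρ.prod ρW).map (fun p => act M (p.1 - c) + act E (p.2 - w₀) + c) = ρ := by
  have := hρW.isProbabilityMeasure
  set ν : Measure (ℕ → Vec m) := Measure.infinitePi fun _ => ρW with hν
  -- Time runs backwards: `w 0` is the latest noise and `σ` discards it, so `Z ∘ σ` is the previous
  -- state. The index `0 + 1 + j` matches `indepFun_tail` at `k = 0`.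
  set σ : (ℕ → Vec m) → ℕ → Vec m := fun w j => w (0 + 1 + j) with hσdef
  have hσ : MeasurePreserving σ ν ν :=
    ⟨by fun_prop, Measure.map_infinitePi_infinitePi_of_inj (P := fun _ : ℕ => ρW)
      (f := fun j => 0 + 1 + j) (fun i j hij => by simpa using hij)⟩
  have h0 : HasLaw (fun w : ℕ → Vec m => w 0) ρW ν :=
    (measurePreserving_eval_infinitePi (fun _ : ℕ => ρW) 0).hasLaw
  have hg : MemLp (fun w : ℕ → Vec m => act E (w 0 - w₀)) 2 ν :=
    memLp_act E ((hρW.memLp_of_hasLaw h0).sub (memLp_const w₀))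
  obtain ⟨Z, hZm, hZ2, hZ⟩ := h.exists_memLp_fixedPoint hσ hg
  have hZc : MemLp (fun w => Z w + c) 2 ν := hZ2.add (memLp_const c)
  refine ⟨ν.map fun w => Z w + c, isP2_map hZc, ?_⟩
  have hind : IndepFun (fun w : ℕ → Vec m => w 0) σ ν :=
    indepFun_tail (W := fun k (w : ℕ → Vec m) => w k) (fun k => by fun_prop)
      (iIndepFun_infinitePi (X := fun _ x => x) (fun _ => measurable_id)) 0
  have hZσ : HasLaw (fun w => Z (σ w) + c) (ν.map fun w => Z w + c) ν :=
    ⟨by fun_prop, by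
      conv_rhs => rw [← hσ.map_eq]
      rw [Measure.map_map (by fun_prop) hσ.measurable]; rfl⟩
  have hpair : IndepFun (fun w => Z (σ w) + c) (fun w : ℕ → Vec m => w 0) ν :=
    hind.symm.comp (φ := fun s => Z s + c) (by fun_prop) measurable_id
  have hlaw := (indepFun_iff_hasLaw_prodMk_prod hZσ h0).1 hpair
  have hF : Measurable fun p : Vec n × Vec m => act M (p.1 - c) + act E (p.2 - w₀) + c := by
    have := measurable_act M
    have := measurable_act E
    fun_prop
  rw [← hlaw.map_eq, Measure.map_map hF (by fun_prop)]
  refine Measure.map_congr ?_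
  filter_upwards [hZ] with w hw
  simp only [Function.comp_apply, add_sub_cancel_right]
  rw [hw]

/-- The law and the independence of a state process that starts in an invariant law. -/
theorem hasLaw_and_indepFun_of_invariant {n m : ℕ} [IsProbabilityMeasure μ] {W : ℕ → Ω → Vec m}
    {ρW : Measure (Vec m)} (hWmeas : ∀ k, Measurable (W k)) (hWlaw : ∀ k, HasLaw (W k) ρW μ)
    (hWindep : iIndepFun W μ) {F : Vec n → Vec m → Vec n} (hF : Measurable (Function.uncurry F))
    {ρ : Measure (Vec n)} (hρ : (ρ.prod ρW).map (Function.uncurry F) = ρ) {X : ℕ → Ω → Vec n}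
    (hX0 : Measurable (X 0)) (hlaw0 : HasLaw (X 0) ρ μ) (hind0 : IndepFun (X 0) (fun ω k => W k ω) μ)
    (hstep : ∀ k ω, X (k + 1) ω = F (X k ω) (W k ω)) (k : ℕ) :
    Measurable (X k) ∧ HasLaw (X k) ρ μ ∧ IndepFun (X k) (fun ω j => W (k + j) ω) μ := by
  -- The induction carries independence from the whole remaining noise; independence from `W k`
  -- alone would not propagate.
  induction k with
  | zero => exact ⟨hX0, hlaw0, by simpa using hind0⟩
  | succ k ih =>
    obtain ⟨hm, hl, hi⟩ := ih
    have heq : X (k + 1) = Function.uncurry F ∘ fun ω => (X k ω, W k ω) := funext (hstep k)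
    have hiW : IndepFun (X k) (W k) μ :=
      hi.comp (ψ := fun w : ℕ → Vec m => w 0) measurable_id (by fun_prop)
    have hi2 : IndepFun (X k) (fun ω => (W k ω, fun j => W (k + 1 + j) ω)) μ := by
      have := hi.comp (φ := id) (ψ := fun w : ℕ → Vec m => (w 0, fun j => w (1 + j)))
        measurable_id (by fun_prop)
      simpa [Function.comp_def, add_assoc] using this
    refine ⟨?_, ?_, ?_⟩
    · rw [heq]; exact hF.comp (hm.prodMk (hWmeas k))
    · have h1 := (indepFun_iff_hasLaw_prodMk_prod hl (hWlaw k)).1 hiW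
      refine ⟨by rw [heq]; exact (hF.comp (hm.prodMk (hWmeas k))).aemeasurable, ?_⟩
      rw [heq, ← Measure.map_map hF (hm.prodMk (hWmeas k)), h1.map_eq, hρ]
    · rw [heq]
      exact (indepFun_prodMk_left hm (hWmeas k) (by fun_prop) hi2
        (indepFun_tail hWmeas hWindep k)).comp hF measurable_id

end Noise

/-! ### Moments, covariances and the stage cost -/

section Expectation

variable {Ω : Type*} [MeasurableSpace Ω] {μ : Measure Ω}

theorem integrable_inner_of_memLp {d : ℕ} {X Y : Ω → Vec d} (hX : MemLp X 2 μ) (hY : MemLp Y 2 μ) :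
    Integrable (fun ω => inner ℝ (X ω) (Y ω)) μ := by
  refine (hX.norm.integrable_mul hY.norm).mono' (hX.1.inner hY.1) (ae_of_all _ fun ω => ?_)
  exact norm_inner_le_norm (X ω) (Y ω)

theorem integrable_inner_act {a b : ℕ} (M : Matrix (Fin a) (Fin b) ℝ) {X : Ω → Vec a}
    {Y : Ω → Vec b} (hX : MemLp X 2 μ) (hY : MemLp Y 2 μ) :
    Integrable (fun ω => inner ℝ (X ω) (act M (Y ω))) μ :=
  integrable_inner_of_memLp hX (memLp_act M hY)

theorem integrable_quad {d : ℕ} (M : Matrix (Fin d) (Fin d) ℝ) {X : Ω → Vec d}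
    (hX : MemLp X 2 μ) : Integrable (fun ω => quad M (X ω)) μ :=
  integrable_inner_act M hX hX

theorem integrable_norm_sq {d : ℕ} {X : Ω → Vec d} (hX : MemLp X 2 μ) :
    Integrable (fun ω => ‖X ω‖ ^ 2) μ :=
  (memLp_two_iff_integrable_sq_norm hX.1).1 hX

theorem Cost.ell_eq_point {n l : ℕ} (C : Cost n l) (X : Ω → Vec n) (U : Ω → Vec l) : C.ell μ X U =
    ∫ ω, C.point (X ω) (U ω) ∂μ + (C.Q₂ * covMat μ X).trace + (C.R₂ * covMat μ U).trace := rfl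

/-- `X` is square integrable and uncorrelated with the random vector `Y`. -/
structure IsUncorrelated (μ : Measure Ω) {d m : ℕ} (Y : Ω → Vec m) (X : Ω → Vec d) : Prop where
  memLp : MemLp X 2 μ
  integral_eq_zero : ∀ N : Matrix (Fin d) (Fin m) ℝ, ∫ ω, inner ℝ (X ω) (act N (Y ω)) ∂μ = 0

variable {d m : ℕ} {Y : Ω → Vec m} {X X' : Ω → Vec d}

/-- Variables that are each independent of the noise need not be jointly independent of it, so their
sum may depend on it. Vanishing cross moments, by contrast, are linear. -/
theorem IsUncorrelated.add (hY : MemLp Y 2 μ) (h : IsUncorrelated μ Y X)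
    (h' : IsUncorrelated μ Y X') : IsUncorrelated μ Y (fun ω => X ω + X' ω) where
  memLp := h.memLp.add h'.memLp
  integral_eq_zero N := by
    simp only [inner_add_left]
    rw [integral_add (integrable_inner_act N h.memLp hY) (integrable_inner_act N h'.memLp hY),
      h.integral_eq_zero, h'.integral_eq_zero, add_zero]

theorem IsUncorrelated.sub (hY : MemLp Y 2 μ) (h : IsUncorrelated μ Y X)
    (h' : IsUncorrelated μ Y X') : IsUncorrelated μ Y (fun ω => X ω - X' ω) where
  memLp := h.memLp.sub h'.memLp
  integral_eq_zero N := by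
    simp only [inner_sub_left]
    rw [integral_sub (integrable_inner_act N h.memLp hY) (integrable_inner_act N h'.memLp hY),
      h.integral_eq_zero, h'.integral_eq_zero, sub_zero]

theorem IsUncorrelated.act {a : ℕ} (M : Matrix (Fin a) (Fin d) ℝ) (h : IsUncorrelated μ Y X) :
    IsUncorrelated μ Y (fun ω => act M (X ω)) where
  memLp := memLp_act M h.memLp
  integral_eq_zero N := by
    simp only [inner_act_left, ← act_mul]
    exact h.integral_eq_zero _

theorem integral_quad_add {d : ℕ} {Q : Matrix (Fin d) (Fin d) ℝ} (hQ : Qᵀ = Q) {X Z : Ω → Vec d}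
    (hX : MemLp X 2 μ) (hZ : MemLp Z 2 μ) :
    ∫ ω, quad Q (X ω + Z ω) ∂μ = ∫ ω, quad Q (X ω) ∂μ
      + 2 * ∫ ω, inner ℝ (X ω) (act Q (Z ω)) ∂μ + ∫ ω, quad Q (Z ω) ∂μ := by
  simp only [quad_add hQ]
  have i1 := integrable_quad Q hX
  have i2 := (integrable_inner_act Q hX hZ).const_mul 2
  rw [integral_add (by exact i1.add i2) (integrable_quad Q hZ), integral_add i1 i2,
    integral_const_mul]

variable [IsProbabilityMeasure μ]

theorem integrable_inner_const {d : ℕ} (q : Vec d) {X : Ω → Vec d} (hX : MemLp X 2 μ) :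
    Integrable (fun ω => inner ℝ q (X ω)) μ :=
  integrable_inner_of_memLp (memLp_const q) hX

theorem integral_inner_const {d : ℕ} (q : Vec d) {X : Ω → Vec d} (hX : MemLp X 2 μ) :
    ∫ ω, inner ℝ q (X ω) ∂μ = inner ℝ q (∫ ω, X ω ∂μ) :=
  integral_inner (hX.integrable one_le_two) q

theorem integral_inner_act_const {a b : ℕ} (M : Matrix (Fin a) (Fin b) ℝ) (y : Vec b)
    {X : Ω → Vec a} (hX : MemLp X 2 μ) :
    ∫ ω, inner ℝ (X ω) (act M y) ∂μ = inner ℝ (∫ ω, X ω ∂μ) (act M y) := by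
  simp only [real_inner_comm (act M y)]
  exact integral_inner_const _ hX

theorem trace_mul_covMat {d : ℕ} (Q : Matrix (Fin d) (Fin d) ℝ) {X : Ω → Vec d}
    (hX : MemLp X 2 μ) :
    (Q * covMat μ X).trace = ∫ ω, quad Q (X ω) ∂μ - quad Q (∫ ω, X ω ∂μ) := by
  have hcoord : ∀ i, MemLp (fun ω => X ω i) 2 μ := fun i =>
    (EuclideanSpace.proj (𝕜 := ℝ) i).comp_memLp' hX
  have hint : ∀ i, (∫ ω, X ω ∂μ) i = ∫ ω, X ω i ∂μ := fun i =>
    ((EuclideanSpace.proj (𝕜 := ℝ) i).integral_comp_comm (hX.integrable one_le_two)).symm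
  have hq : ∀ x : Vec d, quad Q x = ∑ i, ∑ j, Q i j * (x j * x i) := fun x => by
    rw [quad_eq_dotProduct]
    simp only [dotProduct, Matrix.mulVec, Finset.mul_sum]
    exact Finset.sum_congr rfl fun i _ => Finset.sum_congr rfl fun j _ => by ring
  have hprod : ∀ i j, Integrable (fun ω => Q i j * (X ω j * X ω i)) μ := fun i j =>
    ((hcoord j).integrable_mul (hcoord i)).const_mul _
  simp only [hq, hint]
  rw [integral_finsetSum _ fun i _ => integrable_finsetSum _ fun j _ => hprod i j,
    ← Finset.sum_sub_distrib, Matrix.trace]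
  refine Finset.sum_congr rfl fun i _ => ?_
  rw [integral_finsetSum _ fun j _ => hprod i j, ← Finset.sum_sub_distrib, Matrix.diag_apply,
    Matrix.mul_apply]
  refine Finset.sum_congr rfl fun j _ => ?_
  rw [integral_const_mul, ← mul_sub, covMat, Matrix.of_apply, covariance_eq_sub (hcoord j) (hcoord i)]
  rfl

theorem trace_mul_covMat_nonneg {d : ℕ} {Q : Matrix (Fin d) (Fin d) ℝ} (hQ : Q.PosSemidef)
    {X : Ω → Vec d} (hX : MemLp X 2 μ) : 0 ≤ (Q * covMat μ X).trace := by
  rw [trace_mul_covMat Q hX]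
  set m := ∫ ω, X ω ∂μ with hm
  have h1 : 0 ≤ ∫ ω, quad Q (X ω - m) ∂μ := integral_nonneg fun ω => quad_nonneg hQ _
  simp only [quad_sub (transpose_eq_of_posSemidef hQ)] at h1
  have i1 := integrable_quad Q hX
  have i2 := (integrable_inner_act Q hX (memLp_const m)).const_mul 2
  rw [integral_add (by exact i1.sub i2) (integrable_const _), integral_sub i1 i2,
    integral_const_mul, integral_inner_act_const Q m hX, ← hm] at h1
  simp only [integral_const, probReal_univ, one_smul] at h1
  have : inner ℝ m (act Q m) = quad Q m := rfl
  linarith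

variable {n l : ℕ} (C : Cost n l)

theorem Cost.integrable_point {X : Ω → Vec n} {U : Ω → Vec l} (hX : MemLp X 2 μ)
    (hU : MemLp U 2 μ) : Integrable (fun ω => C.point (X ω) (U ω)) μ :=
  ((((integrable_quad C.Q₁ hX).add (integrable_quad C.R₁ hU)).add
    (integrable_inner_const C.s hX)).add (integrable_inner_const C.v hU)).add (integrable_const _)

theorem Cost.ell_const (x : Vec n) (u : Vec l) :
    C.ell μ (fun _ => x) (fun _ => u) = C.point x u := by
  rw [Cost.ell_eq_point, trace_mul_covMat _ (memLp_const x), trace_mul_covMat _ (memLp_const u)]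
  simp

/-- Integrate the pointwise inequality; the covariance terms are nonnegative and vanish at the
constant pair. -/
theorem isErrorDissipative_of_point {m : ℕ} (D : Dynamics n l m) (hQ₂ : C.Q₂.PosSemidef)
    (hR₂ : C.R₂.PosSemidef) {S : Matrix (Fin n) (Fin n) ℝ} {q xt : Vec n} {ut : Vec l} {r : ℝ}
    (h : ∀ x u, r * ‖x - xt‖ ^ 2 ≤ C.point x u - C.point xt ut + (quad S x + inner ℝ q x)
        - (quad S (act D.A x + act D.B u) + inner ℝ q (act D.A x + act D.B u))) :
    IsErrorDissipative D C μ S q xt ut (fun t => r * t) := by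
  intro X U hX hU
  have hX' : MemLp (fun ω => act D.A (X ω) + act D.B (U ω)) 2 μ :=
    (memLp_act D.A hX).add (memLp_act D.B hU)
  have i1 := C.integrable_point hX hU
  have i2 := (integrable_quad S hX).add (integrable_inner_const q hX)
  have i3 := (integrable_quad S hX').add (integrable_inner_const q hX')
  have i0 := (integrable_norm_sq (hX.sub (memLp_const xt))).const_mul r
  have hmono := integral_mono i0 (((i1.sub (integrable_const (C.point xt ut))).add i2).sub i3)
    fun ω => h (X ω) (U ω)
  rw [integral_sub' ((i1.sub (integrable_const _)).add i2) i3,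
    integral_add' (i1.sub (integrable_const _)) i2, integral_sub' i1 (integrable_const _),
    integral_const_mul] at hmono
  simp only [integral_const, probReal_univ, one_smul] at hmono
  rw [Cost.ell_const, Cost.ell_eq_point]
  have t1 := trace_mul_covMat_nonneg hQ₂ hX
  have t2 := trace_mul_covMat_nonneg hR₂ hU
  change r * _ ≤ _ - _ + _ - _ at hmono
  simp only [errorStorage]
  simp only [Pi.add_apply, Pi.sub_apply] at hmono
  linarith

theorem Cost.ell_eq {X : Ω → Vec n} {U : Ω → Vec l} (hX : MemLp X 2 μ) (hU : MemLp U 2 μ) :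
    C.ell μ X U = ∫ ω, quad (C.Q₁ + C.Q₂) (X ω) ∂μ + ∫ ω, quad (C.R₁ + C.R₂) (U ω) ∂μ
      + inner ℝ C.s (∫ ω, X ω ∂μ) + inner ℝ C.v (∫ ω, U ω ∂μ) + C.c
      - quad C.Q₂ (∫ ω, X ω ∂μ) - quad C.R₂ (∫ ω, U ω ∂μ) := by
  simp only [quad_add_matrix]
  have i1 := integrable_quad C.Q₁ hX
  have i2 := integrable_quad C.R₁ hU
  have i3 := integrable_inner_const C.s hX
  have i4 := integrable_inner_const C.v hU
  rw [integral_add i1 (integrable_quad _ hX), integral_add i2 (integrable_quad _ hU), Cost.ell,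
    trace_mul_covMat _ hX, trace_mul_covMat _ hU,
    integral_add (by exact ((i1.add i2).add i3).add i4) (integrable_const _),
    integral_add (by exact (i1.add i2).add i3) i4, integral_add (by exact i1.add i2) i3,
    integral_add i1 i2, integral_inner_const _ hX, integral_inner_const _ hU]
  simp only [integral_const, probReal_univ, one_smul]
  ring

/-- A centered perturbation leaves the means unchanged, so the mean corrections in `Cost.ell_eq`
cancel. This is why the Riccati equation carries the weights `Q₁ + Q₂` and `R₁ + R₂`. -/
theorem Cost.ell_add_centered (hQ₁ : C.Q₁.PosSemidef) (hQ₂ : C.Q₂.PosSemidef)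
    (hR₁ : C.R₁.PosDef) (hR₂ : C.R₂.PosSemidef) {X Z : Ω → Vec n} {U Y : Ω → Vec l}
    (hX : MemLp X 2 μ) (hZ : MemLp Z 2 μ) (hU : MemLp U 2 μ) (hY : MemLp Y 2 μ)
    (hZ0 : ∫ ω, Z ω ∂μ = 0) (hY0 : ∫ ω, Y ω ∂μ = 0) :
    C.ell μ (fun ω => X ω + Z ω) (fun ω => U ω + Y ω) = C.ell μ X U
      + (2 * ∫ ω, inner ℝ (X ω) (act (C.Q₁ + C.Q₂) (Z ω)) ∂μ
        + ∫ ω, quad (C.Q₁ + C.Q₂) (Z ω) ∂μ)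
      + (2 * ∫ ω, inner ℝ (U ω) (act (C.R₁ + C.R₂) (Y ω)) ∂μ
        + ∫ ω, quad (C.R₁ + C.R₂) (Y ω) ∂μ) := by
  have hmX : ∫ ω, (X ω + Z ω) ∂μ = ∫ ω, X ω ∂μ := by
    rw [integral_add (hX.integrable one_le_two) (hZ.integrable one_le_two), hZ0, add_zero]
  have hmU : ∫ ω, (U ω + Y ω) ∂μ = ∫ ω, U ω ∂μ := by
    rw [integral_add (hU.integrable one_le_two) (hY.integrable one_le_two), hY0, add_zero]
  have hXZ : MemLp (fun ω => X ω + Z ω) 2 μ := hX.add hZ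
  have hUY : MemLp (fun ω => U ω + Y ω) 2 μ := hU.add hY
  rw [Cost.ell_eq C hXZ hUY, Cost.ell_eq C hX hU, hmX, hmU,
    integral_quad_add (transpose_eq_of_posSemidef (hQ₁.add hQ₂)) hX hZ,
    integral_quad_add (transpose_eq_of_posSemidef (hR₁.posSemidef.add hR₂)) hU hY]
  ring

theorem covMat_add_const {d : ℕ} {X : Ω → Vec d} (hX : MemLp X 2 μ) (a : Vec d) :
    covMat μ (fun ω => X ω + a) = covMat μ X := by
  have hcoord : ∀ i, Integrable (fun ω => X ω i) μ := fun i =>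
    ((EuclideanSpace.proj (𝕜 := ℝ) i).comp_memLp' hX).integrable one_le_two
  ext i j
  simp only [covMat, Matrix.of_apply, PiLp.add_apply]
  rw [covariance_add_const_left (hcoord i), covariance_add_const_right (hcoord j)]

theorem Cost.ell_shift (hQ₁ : C.Q₁.PosSemidef) (hR₁ : C.R₁.PosDef) (xs : Vec n) (us : Vec l)
    {X : Ω → Vec n} {U : Ω → Vec l} (hX : MemLp X 2 μ) (hU : MemLp U 2 μ) :
    C.ell μ (fun ω => X ω + xs) (fun ω => U ω + us) = (C.shift xs us).ell μ X U := by
  rw [Cost.ell_eq_point, Cost.ell_eq_point, covMat_add_const hX, covMat_add_const hU]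
  have : ∀ x u, C.point (x + xs) (u + us) = (C.shift xs us).point x u := fun x u => by
    simp only [Cost.point, Cost.shift, quad_add (transpose_eq_of_posSemidef hQ₁),
      quad_add (transpose_eq_of_posSemidef hR₁.posSemidef), inner_add_right, inner_add_left,
      real_inner_smul_left, real_inner_comm x (act C.Q₁ xs), real_inner_comm u (act C.R₁ us)]
    ring
  simp only [this]
  rfl

theorem isUncorrelated_of_indepFun (hX : MemLp X 2 μ) (hY : MemLp Y 2 μ) (h : IndepFun X Y μ)
    (hY0 : ∫ ω, Y ω ∂μ = 0) : IsUncorrelated μ Y X where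
  memLp := hX
  integral_eq_zero N := by
    have hN : IndepFun X (fun ω => StochLQ.act N (Y ω)) μ := h.comp measurable_id (measurable_act N)
    have h1 := hN.integral_bilin (hX.integrable one_le_two)
      ((memLp_act N hY).integrable one_le_two) (innerSL ℝ)
    change ∫ ω, inner ℝ (X ω) (StochLQ.act N (Y ω)) ∂μ =
      inner ℝ (∫ ω, X ω ∂μ) (∫ ω, StochLQ.act N (Y ω) ∂μ) at h1
    rw [h1, integral_act N (hY.integrable one_le_two), hY0]
    simp

end Expectation

/-! ### Adjoint identities and the storage function -/

section Dissipativity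

variable {n l m : ℕ} {D : Dynamics n l m} {C : Cost n l}

theorem isRiccatiSolution_iff {P : Matrix (Fin n) (Fin n) ℝ} : IsRiccatiSolution D C P ↔
    P.PosSemidef ∧ riccatiMap D.A D.B (C.Q₁ + C.Q₂) (C.R₁ + C.R₂) P = P :=
  and_congr_right fun _ => eq_comm

theorem isClassKInfty_mul_left {r : ℝ} (hr : 0 < r) : IsClassKInfty (fun t => r * t) where
  continuousOn := by fun_prop
  strictMonoOn := fun _ _ _ _ h => mul_lt_mul_of_pos_left h hr
  map_zero := mul_zero r
  unbounded c := ⟨(|c| + 1) / r, by positivity, by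
    rw [mul_div_cancel₀ _ hr.ne']; linarith [le_abs_self c]⟩

/-- The adjoint equation: the Riccati equation reads `P = Q + Aᵀ P (A + B K)` with `Q = Q₁ + Q₂`. -/
theorem IsRiccatiSolution.cross_state {P : Matrix (Fin n) (Fin n) ℝ} (h : IsRiccatiSolution D C P)
    (x z : Vec n) :
    inner ℝ x (act (C.Q₁ + C.Q₂) z)
      + inner ℝ (act D.A x) (act P (act (D.A + D.B * gain D C P) z)) = inner ℝ x (act P z) := by
  have h1 : P = D.Aᵀ * P * D.A + (C.Q₁ + C.Q₂) + D.Aᵀ * P * D.B * gain D C P :=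
    (isRiccatiSolution_iff.1 h).2.symm.trans (riccatiMap_eq P)
  conv_rhs => rw [h1]
  rw [inner_act_left, ← act_mul, ← act_mul, ← inner_add_right, ← act_add_matrix]
  have h2 : C.Q₁ + C.Q₂ + D.Aᵀ * P * (D.A + D.B * gain D C P)
      = D.Aᵀ * P * D.A + (C.Q₁ + C.Q₂) + D.Aᵀ * P * D.B * gain D C P := by
    rw [Matrix.mul_add]
    simp only [Matrix.mul_assoc]
    abel
  rw [h2]

/-- Stationarity in the control: the definition of `K` gives `R K + Bᵀ P (A + B K) = 0` with `R = R₁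
+ R₂`. -/
theorem IsRiccatiSolution.cross_control {P : Matrix (Fin n) (Fin n) ℝ}
    (h : IsRiccatiSolution D C P) (hR : (C.R₁ + C.R₂).PosDef) (u : Vec l) (z : Vec n) :
    inner ℝ u (act (C.R₁ + C.R₂) (act (gain D C P) z))
      + inner ℝ (act D.B u) (act P (act (D.A + D.B * gain D C P) z)) = 0 := by
  have h1 : ((C.R₁ + C.R₂) + D.Bᵀ * P * D.B) * gain D C P = -(D.Bᵀ * P * D.A) :=
    mul_riccatiGain hR h.1
  have h2 : (C.R₁ + C.R₂) * gain D C P + D.Bᵀ * P * (D.A + D.B * gain D C P) = 0 := by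
    rw [Matrix.add_mul, ← eq_sub_iff_add_eq] at h1
    rw [h1, Matrix.mul_add]
    simp only [Matrix.mul_assoc]
    abel
  rw [inner_act_left, ← act_mul, ← act_mul, ← act_mul, ← inner_add_right, ← act_add_matrix, h2,
    act_zero_matrix, inner_zero_right]

theorem Dynamics.f_feedback (D : Dynamics n l m) (K : Matrix (Fin l) (Fin n) ℝ) {xs xt : Vec n}
    {us ut : Vec l} {w₀ : Vec m} (hs : act (1 - D.A) xs - act D.B us = act D.E w₀ + D.z)
    (ht : act (1 - D.A) xt - act D.B ut = 0) (x : Vec n) (w : Vec m) :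
    D.f x (act K (x - xt - xs) + ut + us) w
      = act (D.A + D.B * K) (x - (xt + xs)) + act D.E (w - w₀) + (xt + xs) := by
  rw [act_sub_matrix, act_one] at hs ht
  rw [Dynamics.f, act_add_matrix, act_mul]
  simp only [map_add, map_sub]
  linear_combination (norm := module) -ht - hs

variable {Ω : Type*} [MeasurableSpace Ω] {μ : Measure Ω} [IsProbabilityMeasure μ]

/-- Since `X - xs = Y + Z`, the forms `‖Y‖_P²` cancel, leaving the error storage, a term linear in
`Y` and a term in `Z` alone. -/
theorem storage_eq {P S : Matrix (Fin n) (Fin n) ℝ} (hP : P.PosSemidef) (q xs xt : Vec n)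
    {Xs : ℕ → Ω → Vec n} {k : ℕ} {X : Ω → Vec n} (hX : MemLp X 2 μ) (hXs : MemLp (Xs k) 2 μ) :
    storage μ P S q xs xt Xs k X = errorStorage μ S q (fun ω => X ω - (Xs k ω - xt))
      - (2 * ∫ ω, inner ℝ (X ω - (Xs k ω - xt)) (act P (Xs k ω - xt - xs)) ∂μ
        + ∫ ω, quad P (Xs k ω - xt - xs) ∂μ) := by
  have hZ : MemLp (fun ω => Xs k ω - xt - xs) 2 μ := (hXs.sub (memLp_const xt)).sub (memLp_const xs)
  have hY : MemLp (fun ω => X ω - (Xs k ω - xt)) 2 μ := hX.sub (hXs.sub (memLp_const xt))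
  have i1 := (integrable_inner_act P hY hZ).const_mul 2
  have i2 := integrable_quad P hZ
  rw [errorStorage, ← integral_const_mul, ← integral_add i1 i2, ← integral_sub
    (by exact (integrable_quad S hY).add (integrable_inner_const q hY)) (by exact i1.add i2),
    storage]
  refine integral_congr_ae (ae_of_all _ fun ω => ?_)
  have h1 : X ω - xs = (X ω - (Xs k ω - xt)) + (Xs k ω - xt - xs) := by abel
  simp only
  rw [h1, quad_add_matrix, quad_add (transpose_eq_of_posSemidef hP)]
  ring

theorem exists_le_storage {P S : Matrix (Fin n) (Fin n) ℝ} (hP : P.PosSemidef) (hS : S.PosDef)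
    (q xs xt : Vec n) {Xs : ℕ → Ω → Vec n} {ρX : Measure (Vec n)} (hρX : IsP2 ρX)
    (hlaw : ∀ k, HasLaw (Xs k) ρX μ) :
    ∃ b : ℝ, ∀ k X, MemLp X 2 μ → b ≤ storage μ P S q xs xt Xs k X := by
  obtain ⟨a, ha, hSa⟩ := exists_le_quad hS
  -- Half of `a ‖y‖²` absorbs `-2 ⟪y, z⟫`, where `z = P (Xs k - xt - xs)`, and half absorbs `⟪q,
  -- y⟫`. The rest depends only on `Xs k`, whose law does not vary with `k`, so the bound is
  -- uniform.
  set g : Vec n → ℝ := fun x => -(2 / a * ‖act P (x - xt - xs)‖ ^ 2 + quad P (x - xt - xs)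
    + (2 * a)⁻¹ * ‖q‖ ^ 2) with hg
  refine ⟨∫ x, g x ∂ρX, fun k X hX => ?_⟩
  have hXs := hρX.memLp_of_hasLaw (hlaw k)
  have hgc : Continuous g := by
    have := continuous_act P
    have := continuous_quad P
    fun_prop
  rw [← (hlaw k).integral_comp hgc.aestronglyMeasurable]
  have hZ : MemLp (fun ω => Xs k ω - xt - xs) 2 μ := (hXs.sub (memLp_const xt)).sub (memLp_const xs)
  have hY : MemLp (fun ω => X ω - (Xs k ω - xt)) 2 μ := hX.sub (hXs.sub (memLp_const xt))
  refine integral_mono ?_ ?_ fun ω => ?_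
  · exact ((((integrable_norm_sq (memLp_act P hZ)).const_mul _).add (integrable_quad P hZ)).add
      (integrable_const _)).neg
  · exact ((integrable_quad (P + S) hY).sub (integrable_quad P (hX.sub (memLp_const xs)))).add
      (integrable_inner_const q hY)
  · have h1 : X ω - xs = (X ω - (Xs k ω - xt)) + (Xs k ω - xt - xs) := by abel
    simp only [hg, Function.comp_apply]
    rw [h1, quad_add_matrix, quad_add (transpose_eq_of_posSemidef hP)]
    set y := X ω - (Xs k ω - xt)
    set z := act P (Xs k ω - xt - xs)
    have e1 := hSa y
    have e2 : 0 ≤ (2 / a) * ‖(a / 2) • y - z‖ ^ 2 := by positivity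
    have e3 : 0 ≤ (2 * a)⁻¹ * ‖a • y + q‖ ^ 2 := by positivity
    rw [norm_sub_sq_real, real_inner_smul_left, norm_smul, Real.norm_of_nonneg (by positivity)] at e2
    rw [norm_add_sq_real, real_inner_smul_left, norm_smul, Real.norm_of_nonneg ha.le,
      real_inner_comm] at e3
    have e2' : 2 / a * ((a / 2 * ‖y‖) ^ 2 - 2 * (a / 2 * inner ℝ y z) + ‖z‖ ^ 2)
        = a / 2 * ‖y‖ ^ 2 - 2 * inner ℝ y z + 2 / a * ‖z‖ ^ 2 := by field_simp
    have e3' : (2 * a)⁻¹ * ((a * ‖y‖) ^ 2 + 2 * (a * inner ℝ q y) + ‖q‖ ^ 2)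
        = a / 2 * ‖y‖ ^ 2 + inner ℝ q y + (2 * a)⁻¹ * ‖q‖ ^ 2 := by field_simp
    linarith

end Dissipativity

/-! ### Stationary pair and dissipation inequality -/

section Main

variable {n l m : ℕ} {D : Dynamics n l m} {C : Cost n l}
variable {Ω : Type*} [MeasurableSpace Ω] {μ : Measure Ω} [IsProbabilityMeasure μ]

/-- The mean of a stationary solution of a stable affine recursion is its fixed point. -/
theorem IsLyapunov.integral_eq_of_stationary {V M : Matrix (Fin n) (Fin n) ℝ} {r : ℝ}
    (h : IsLyapunov V M r) {X X' : Ω → Vec n} {N : Ω → Vec n} {c : Vec n} (hX : MemLp X 2 μ)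
    (hN : MemLp N 2 μ) (hN0 : ∫ ω, N ω ∂μ = 0) (hstep : ∀ ω, X' ω = act M (X ω - c) + N ω + c)
    (hmean : ∫ ω, X' ω ∂μ = ∫ ω, X ω ∂μ) : ∫ ω, X ω ∂μ = c := by
  have hXc : MemLp (fun ω => X ω - c) 2 μ := hX.sub (memLp_const c)
  have hi := (memLp_act M hXc).integrable one_le_two
  have hNi := hN.integrable one_le_two
  have h1 : ∫ ω, X' ω ∂μ = act M (∫ ω, X ω ∂μ - c) + c := by
    simp only [hstep]
    rw [integral_add (by exact hi.add hNi) (integrable_const c), integral_add hi hNi, hN0,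
      integral_act M (hXc.integrable one_le_two),
      integral_sub (hX.integrable one_le_two) (integrable_const c)]
    simp
  rw [hmean] at h1
  exact sub_eq_zero.1 (h.eq_zero_of_act_eq (eq_sub_of_add_eq h1.symm))

/-- The dissipation inequality at the stationary pair follows from strict dissipativity of the
noise-free error system. -/
theorem dissipation_of_isErrorDissipative {W : ℕ → Ω → Vec m} {ρW : Measure (Vec m)}
    (hQ₁ : C.Q₁.PosSemidef) (hQ₂ : C.Q₂.PosSemidef) (hR₁ : C.R₁.PosDef) (hR₂ : C.R₂.PosSemidef)
    (hρW : IsP2 ρW) (hWlaw : ∀ k, HasLaw (W k) ρW μ)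
    {xs xt q : Vec n} {us ut : Vec l} {P S : Matrix (Fin n) (Fin n) ℝ} {α : ℝ → ℝ}
    (hs : act (1 - D.A) xs - act D.B us = act D.E (∫ w, w ∂ρW) + D.z)
    (ht : act (1 - D.A) xt - act D.B ut = 0) (hP : IsRiccatiSolution D C P)
    (herr : IsErrorDissipative D (C.shift xs us) μ S q xt ut α)
    {Xs : ℕ → Ω → Vec n} {Us : ℕ → Ω → Vec l} {ρX : Measure (Vec n)} {ρU : Measure (Vec l)}
    (hst : IsStationaryPair D μ W Xs Us ρX ρU)
    (hUs : ∀ k ω, Us k ω = act (gain D C P) (Xs k ω - xt - xs) + ut + us)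
    (hmean : ∀ k, ∫ ω, Xs k ω ∂μ = xt + xs) (k : ℕ) {X : Ω → Vec n} {U : Ω → Vec l}
    (hX : MemLp X 2 μ) (hU : MemLp U 2 μ) (hXW : IndepFun X (W k) μ) (hUW : IndepFun U (W k) μ) :
    α (∫ ω, ‖X ω - Xs k ω‖ ^ 2 ∂μ) ≤
      C.ell μ X U - C.ell μ (Xs k) (Us k) + storage μ P S q xs xt Xs k X
        - storage μ P S q xs xt Xs (k + 1) (fun ω => D.f (X ω) (U ω) (W k ω)) := by
  have := hρW.isProbabilityMeasure
  set K := gain D C P with hK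
  set M := D.A + D.B * K with hM
  set w₀ := ∫ w, w ∂ρW with hw₀
  have hXs : ∀ k, MemLp (Xs k) 2 μ := fun k => hst.isP2_state.memLp_of_hasLaw (hst.law_state k)
  have hUs2 : MemLp (Us k) 2 μ := hst.isP2_control.memLp_of_hasLaw (hst.law_control k)
  have hW : MemLp (W k) 2 μ := hρW.memLp_of_hasLaw (hWlaw k)
  -- the error variables, the centered stationary state and the centered noise
  set Y : Ω → Vec n := fun ω => X ω - (Xs k ω - xt) with hYdef
  set T : Ω → Vec l := fun ω => U ω - (Us k ω - ut) with hTdef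
  set Z : Ω → Vec n := fun ω => Xs k ω - xt - xs with hZdef
  set N : Ω → Vec m := fun ω => W k ω - w₀ with hNdef
  have hY : MemLp Y 2 μ := hX.sub ((hXs k).sub (memLp_const xt))
  have hT : MemLp T 2 μ := hU.sub (hUs2.sub (memLp_const ut))
  have hZ : MemLp Z 2 μ := ((hXs k).sub (memLp_const xt)).sub (memLp_const xs)
  have hKZ : MemLp (fun ω => act K (Z ω)) 2 μ := memLp_act K hZ
  have hN : MemLp N 2 μ := hW.sub (memLp_const w₀)
  have hN0 : ∫ ω, N ω ∂μ = 0 := by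
    rw [hNdef, integral_sub (hW.integrable one_le_two) (integrable_const _), (hWlaw k).integral_eq]
    simp [hw₀]
  have hZ0 : ∫ ω, Z ω ∂μ = 0 := by
    have : Z = fun ω => Xs k ω - (xt + xs) := by funext ω; simp only [hZdef, sub_sub]
    rw [this, integral_sub ((hXs k).integrable one_le_two) (integrable_const _), hmean]
    simp
  have hKZ0 : ∫ ω, act K (Z ω) ∂μ = 0 := by
    rw [integral_act K (hZ.integrable one_le_two), hZ0]; simp
  -- the stage costs
  have hellX : C.ell μ X U = (C.shift xs us).ell μ Y T
      + (2 * ∫ ω, inner ℝ (Y ω) (act (C.Q₁ + C.Q₂) (Z ω)) ∂μ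
        + ∫ ω, quad (C.Q₁ + C.Q₂) (Z ω) ∂μ)
      + (2 * ∫ ω, inner ℝ (T ω) (act (C.R₁ + C.R₂) (act K (Z ω))) ∂μ
        + ∫ ω, quad (C.R₁ + C.R₂) (act K (Z ω)) ∂μ) := by
    have e1 : X = fun ω => (Y ω + Z ω) + xs := by funext ω; simp only [hYdef, hZdef]; abel
    have e2 : U = fun ω => (T ω + act K (Z ω)) + us := by
      funext ω; simp only [hTdef, hZdef, hUs]; abel
    conv_lhs => rw [e1, e2]
    refine (Cost.ell_shift C hQ₁ hR₁ xs us (hY.add hZ) (hT.add hKZ)).trans ?_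
    exact Cost.ell_add_centered (C.shift xs us) hQ₁ hQ₂ hR₁ hR₂ hY hZ hT hKZ hZ0 hKZ0
  have hellXs : C.ell μ (Xs k) (Us k) = (C.shift xs us).ell μ (fun _ => xt) (fun _ => ut)
      + ∫ ω, quad (C.Q₁ + C.Q₂) (Z ω) ∂μ + ∫ ω, quad (C.R₁ + C.R₂) (act K (Z ω)) ∂μ := by
    have e1 : Xs k = fun ω => (xt + Z ω) + xs := by funext ω; simp only [hZdef]; abel
    have e2 : Us k = fun ω => (ut + act K (Z ω)) + us := by
      funext ω; simp only [hZdef, hUs]; abel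
    conv_lhs => rw [e1, e2]
    refine (Cost.ell_shift C hQ₁ hR₁ xs us ((memLp_const xt).add hZ)
      ((memLp_const ut).add hKZ)).trans ?_
    have h1 := Cost.ell_add_centered (μ := μ) (C.shift xs us) hQ₁ hQ₂ hR₁ hR₂ (memLp_const xt) hZ
      (memLp_const ut) hKZ hZ0 hKZ0
    have z1 : ∫ ω, inner ℝ xt (act (C.Q₁ + C.Q₂) (Z ω)) ∂μ = 0 := by
      rw [integral_inner_const xt (memLp_act _ hZ), integral_act _ (hZ.integrable one_le_two), hZ0]
      simp
    have z2 : ∫ ω, inner ℝ ut (act (C.R₁ + C.R₂) (act K (Z ω))) ∂μ = 0 := by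
      rw [integral_inner_const ut (memLp_act _ hKZ), integral_act _ (hKZ.integrable one_le_two),
        hKZ0]
      simp
    refine h1.trans ?_
    change _ + (2 * ∫ ω, inner ℝ xt (act (C.Q₁ + C.Q₂) (Z ω)) ∂μ + _)
      + (2 * ∫ ω, inner ℝ ut (act (C.R₁ + C.R₂) (act K (Z ω))) ∂μ + _) = _
    rw [z1, z2, mul_zero, zero_add, zero_add]
    rfl
  -- the storage functions
  have hfX : MemLp (fun ω => D.f (X ω) (U ω) (W k ω)) 2 μ :=
    (((memLp_act D.A hX).add (memLp_act D.B hU)).add (memLp_act D.E hW)).add (memLp_const D.z)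
  have hlam := storage_eq (S := S) hP.1 q xs xt hX (hXs k)
  have hlam' := storage_eq (S := S) hP.1 q xs xt hfX (hXs (k + 1))
  have hxt : xt = act D.A xt + act D.B ut := by
    rw [act_sub_matrix, act_one, sub_sub, sub_eq_zero] at ht; exact ht
  -- The noise and `z` drop out of the difference of the two trajectories.
  have hY' : ∀ ω, D.f (X ω) (U ω) (W k ω) - (Xs (k + 1) ω - xt) = act D.A (Y ω) + act D.B (T ω) := by
    intro ω
    rw [hst.step]
    simp only [Dynamics.f, hYdef, hTdef, map_sub]
    linear_combination (norm := module) hxt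
  have hZ' : ∀ ω, Xs (k + 1) ω - xt - xs = act M (Z ω) + act D.E (N ω) := by
    intro ω
    rw [hst.step, hUs, D.f_feedback K hs ht, ← sub_sub (Xs k ω)]
    simp only [hZdef, hNdef, hM]
    abel
  have hquadP : ∫ ω, quad P (Xs (k + 1) ω - xt - xs) ∂μ = ∫ ω, quad P (Z ω) ∂μ := by
    have hc : Continuous fun x : Vec n => quad P (x - xt - xs) := by
      have := continuous_quad P
      fun_prop
    have h1 := (hst.law_state (k + 1)).integral_comp (f := fun x => quad P (x - xt - xs))
      hc.aestronglyMeasurable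
    have h2 := (hst.law_state k).integral_comp (f := fun x => quad P (x - xt - xs))
      hc.aestronglyMeasurable
    exact h1.trans h2.symm
  -- the noise is uncorrelated with the successor of the error
  have hindep : ∀ {d : ℕ} {V : Ω → Vec d}, MemLp V 2 μ → IndepFun V (W k) μ →
      IsUncorrelated μ N V := fun hV hVW =>
    isUncorrelated_of_indepFun hV hN
      (hVW.comp (ψ := fun w => w - w₀) measurable_id (by fun_prop)) hN0
  have hconst : ∀ {d : ℕ} (v : Vec d), IsUncorrelated μ N (fun _ => v) := fun v =>
    hindep (memLp_const v) (indepFun_const_left v (W k))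
  have hunc : IsUncorrelated μ N (fun ω => act D.A (Y ω) + act D.B (T ω)) :=
    (((hindep hX hXW).sub hN ((hindep (hXs k) (hst.indep_state k)).sub hN (hconst xt))).act
      D.A).add hN
      (((hindep hU hUW).sub hN ((hindep hUs2 (hst.indep_control k)).sub hN (hconst ut))).act D.B)
  have hAY := memLp_act D.A hY
  have hBT := memLp_act D.B hT
  have hMZ := memLp_act M hZ
  -- The noise in the successor of `Z` meets only a variable uncorrelated with it, so just the part
  -- `M Z` survives.
  have hcross : ∫ ω, inner ℝ (act D.A (Y ω) + act D.B (T ω))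
        (act P (act M (Z ω) + act D.E (N ω))) ∂μ
      = ∫ ω, inner ℝ (act D.A (Y ω)) (act P (act M (Z ω))) ∂μ
        + ∫ ω, inner ℝ (act D.B (T ω)) (act P (act M (Z ω))) ∂μ := by
    have h0 := hunc.integral_eq_zero (P * D.E)
    have i1 := integrable_inner_act P hAY hMZ
    have i2 := integrable_inner_act P hBT hMZ
    have i3 := integrable_inner_act (P * D.E) hunc.memLp hN
    rw [← add_zero (∫ ω, inner ℝ (act D.A (Y ω)) (act P (act M (Z ω))) ∂μ + _), ← h0,
      ← integral_add i1 i2, ← integral_add (by exact i1.add i2) i3]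
    refine integral_congr_ae (ae_of_all _ fun ω => ?_)
    simp only [map_add, inner_add_left, inner_add_right, act_mul]
  have hstate : ∫ ω, inner ℝ (Y ω) (act (C.Q₁ + C.Q₂) (Z ω)) ∂μ
      + ∫ ω, inner ℝ (act D.A (Y ω)) (act P (act M (Z ω))) ∂μ
      = ∫ ω, inner ℝ (Y ω) (act P (Z ω)) ∂μ := by
    rw [← integral_add (integrable_inner_act _ hY hZ) (integrable_inner_act P hAY hMZ)]
    exact integral_congr_ae (ae_of_all _ fun ω => hP.cross_state (Y ω) (Z ω))
  have hcontrol : ∫ ω, inner ℝ (T ω) (act (C.R₁ + C.R₂) (act K (Z ω))) ∂μ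
      + ∫ ω, inner ℝ (act D.B (T ω)) (act P (act M (Z ω))) ∂μ = 0 := by
    rw [← integral_add (integrable_inner_act _ hT hKZ) (integrable_inner_act P hBT hMZ)]
    simp only [hP.cross_control (hR₁.add_posSemidef hR₂), hK, hM, integral_zero]
  have hnorm : ∫ ω, ‖X ω - Xs k ω‖ ^ 2 ∂μ = ∫ ω, ‖Y ω - xt‖ ^ 2 ∂μ := by
    simp only [hYdef, sub_sub, sub_add_cancel]
  have herr' := herr Y T hY hT
  simp only [hY', hZ', hcross] at hlam'
  simp only [hZ'] at hquadP
  rw [hnorm, hellX, hellXs, hlam, hlam']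
  linarith

theorem exists_stationaryPair {W : ℕ → Ω → Vec m} {ρW : Measure (Vec m)} (hρW : IsP2 ρW)
    (hWmeas : ∀ k, Measurable (W k)) (hWlaw : ∀ k, HasLaw (W k) ρW μ) (hWindep : iIndepFun W μ)
    (hΩ : ∀ ρ : Measure (Vec n), IsP2 ρ → ∃ X₀ : Ω → Vec n, Measurable X₀ ∧ HasLaw X₀ ρ μ ∧
      IndepFun X₀ (fun ω k => W k ω) μ) {xs xt : Vec n} {us ut : Vec l}
    (hs : act (1 - D.A) xs - act D.B us = act D.E (∫ w, w ∂ρW) + D.z)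
    (ht : act (1 - D.A) xt - act D.B ut = 0) {K : Matrix (Fin l) (Fin n) ℝ}
    {V : Matrix (Fin n) (Fin n) ℝ} {r : ℝ} (hV : IsLyapunov V (D.A + D.B * K) r) :
    ∃ (ρX : Measure (Vec n)) (ρU : Measure (Vec l)) (Xs : ℕ → Ω → Vec n) (Us : ℕ → Ω → Vec l),
      IsInvariant D ρW (fun x => act K (x - xt - xs) + ut + us) ρX ∧
      IndepFun (Xs 0) (fun ω k => W k ω) μ ∧
      (∀ k ω, Us k ω = act K (Xs k ω - xt - xs) + ut + us) ∧
      IsStationaryPair D μ W Xs Us ρX ρU ∧ ∀ k, ∫ ω, Xs k ω ∂μ = xt + xs := by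
  have := hρW.isProbabilityMeasure
  set w₀ := ∫ w, w ∂ρW with hw₀
  set π : Vec n → Vec l := fun x => act K (x - xt - xs) + ut + us with hπ
  have hπm : Measurable π := by
    have := measurable_act K
    fun_prop
  obtain ⟨ρX, hρX, hinv⟩ := hV.exists_invariant D.E (xt + xs) w₀ hρW
  have hinv' : IsInvariant D ρW π ρX := by
    simp only [IsInvariant, hπ, D.f_feedback K hs ht]
    exact hinv
  obtain ⟨X₀, hX₀m, hX₀, hX₀W⟩ := hΩ ρX hρX
  -- The invariant law comes from an auxiliary sequence space; the process itself runs forward on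
  -- `Ω` from a sample of that law.
  let Xs : ℕ → Ω → Vec n := fun k => Nat.rec X₀ (fun j X ω => D.f (X ω) (π (X ω)) (W j ω)) k
  have hF : Measurable (Function.uncurry fun x w => D.f x (π x) w) := by
    have := measurable_act D.A
    have := measurable_act D.B
    have := measurable_act D.E
    simp only [Function.uncurry_def, Dynamics.f]
    fun_prop
  have hall := hasLaw_and_indepFun_of_invariant (X := Xs) hWmeas hWlaw hWindep hF hinv' hX₀m hX₀
    hX₀W (fun k ω => rfl)
  have hXs2 : ∀ k, MemLp (Xs k) 2 μ := fun k => hρX.memLp_of_hasLaw (hall k).2.1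
  have hπ2 : MemLp π 2 ρX := by
    have := hρX.isProbabilityMeasure
    exact (((memLp_act K ((hρX.memLp_id.sub (memLp_const xt)).sub (memLp_const xs))).add
      (memLp_const ut)).add (memLp_const us))
  have hindW : ∀ k, IndepFun (Xs k) (W k) μ := fun k =>
    (hall k).2.2.comp (ψ := fun w : ℕ → Vec m => w 0) measurable_id (by fun_prop)
  have := hρX.isProbabilityMeasure
  refine ⟨ρX, ρX.map π, Xs, fun k ω => π (Xs k ω), hinv', hX₀W, fun k ω => rfl,
    ⟨hρX, isP2_map hπ2, fun k => (hall k).2.1, fun k => ?_, hindW, fun k => ?_, fun k ω => rfl⟩,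
    fun k => ?_⟩
  · exact HasLaw.fun_comp ⟨hπm.aemeasurable, rfl⟩ (hall k).2.1
  · exact (hindW k).comp hπm measurable_id
  · have hW2 := hρW.memLp_of_hasLaw (hWlaw k)
    refine hV.integral_eq_of_stationary (X' := Xs (k + 1))
      (N := fun ω => act D.E (W k ω - w₀)) (hXs2 k)
      (memLp_act D.E (hW2.sub (memLp_const w₀))) ?_
      (fun ω => D.f_feedback K hs ht (Xs k ω) (W k ω)) ?_
    · rw [integral_act D.E (by exact (hW2.integrable one_le_two).sub (integrable_const w₀)),
        integral_sub (hW2.integrable one_le_two) (integrable_const _), (hWlaw k).integral_eq]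
      simp [hw₀]
    · rw [(hall (k + 1)).2.1.integral_eq, (hall k).2.1.integral_eq]

end Main

end StochLQ

theorem mainTheorem1 {n l m : ℕ} (D : StochLQ.Dynamics n l m) (C : StochLQ.Cost n l)
    (hAB : StochLQ.IsStabilizable D.A D.B)
    (hQ₁ : C.Q₁.PosSemidef) (hQ₂ : C.Q₂.PosSemidef) (hR₁ : C.R₁.PosDef) (hR₂ : C.R₂.PosSemidef)
    {Ω : Type*} [MeasurableSpace Ω] (μ : Measure Ω) [IsProbabilityMeasure μ]
    -- the noise: an i.i.d. sequence with law `ρW` of finite second moment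
    (W : ℕ → Ω → StochLQ.Vec m) (ρW : Measure (StochLQ.Vec m)) (hρW : StochLQ.IsP2 ρW)
    (hWmeas : ∀ k, Measurable (W k)) (hWlaw : ∀ k, HasLaw (W k) ρW μ) (hWindep : iIndepFun W μ)
    -- the probability space carries initial values of every law, independent of the noise
    (hΩ : ∀ ρ : Measure (StochLQ.Vec n), StochLQ.IsP2 ρ →
      ∃ X₀ : Ω → StochLQ.Vec n, Measurable X₀ ∧ HasLaw X₀ ρ μ ∧
        IndepFun X₀ (fun ω k => W k ω) μ)
    -- a steady state of the deterministic system
    (xs : StochLQ.Vec n) (us : StochLQ.Vec l)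
    (hs : StochLQ.act (1 - D.A) xs - StochLQ.act D.B us
      = StochLQ.act D.E (∫ w, w ∂ρW) + D.z)
    (hdet : StochLQ.IsDetectable D.A (CFC.sqrt C.Q₁)) :
    -- the positive semidefinite solution of the Riccati equation
    ∃ P : Matrix (Fin n) (Fin n) ℝ, StochLQ.IsRiccatiSolution D C P ∧
      (∀ P', StochLQ.IsRiccatiSolution D C P' → P' = P) ∧
    -- the data of the error system, with the linear comparison function `α(t) = r t`
    ∃ (S : Matrix (Fin n) (Fin n) ℝ) (q xt : StochLQ.Vec n) (ut : StochLQ.Vec l) (r : ℝ),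
      S.PosDef ∧ 0 < r ∧
      StochLQ.act (1 - D.A) xt - StochLQ.act D.B ut = 0 ∧
      StochLQ.IsErrorDissipative D (C.shift xs us) μ S q xt ut (fun t => r * t) ∧
    -- the invariant distribution and the stationary pair
    ∃ (ρX : Measure (StochLQ.Vec n)) (ρU : Measure (StochLQ.Vec l))
      (Xs : ℕ → Ω → StochLQ.Vec n) (Us : ℕ → Ω → StochLQ.Vec l),
      StochLQ.IsInvariant D ρW
        (fun x => StochLQ.act (StochLQ.gain D C P) (x - xt - xs) + ut + us) ρX ∧
      IndepFun (Xs 0) (fun ω k => W k ω) μ ∧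
      (∀ k ω, Us k ω = StochLQ.act (StochLQ.gain D C P) (Xs k ω - xt - xs) + ut + us) ∧
      StochLQ.IsStationaryPair D μ W Xs Us ρX ρU ∧
      StochLQ.IsStrictlyDissipative D C μ W Xs Us
        (StochLQ.storage μ P S q xs xt Xs) (fun t => r * t) := by
  have hR : (C.R₁ + C.R₂).PosDef := hR₁.add_posSemidef hR₂
  obtain ⟨S, r, hS, hr, hdiss⟩ := hdet.exists_storage D.B hQ₁ hR₁
  -- Enlarging the weights by `Q₂` and `R₂` only increases the supply rate, so one `S` serves both
  -- the error system and the Riccati closed loop.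
  have hdiss' : ∀ x u, r * ‖x‖ ^ 2 ≤ StochLQ.quad (C.Q₁ + C.Q₂) x + StochLQ.quad (C.R₁ + C.R₂) u
      + StochLQ.quad S x - StochLQ.quad S (StochLQ.act D.A x + StochLQ.act D.B u) := by
    intro x u
    rw [StochLQ.quad_add_matrix, StochLQ.quad_add_matrix]
    linarith [hdiss x u, StochLQ.quad_nonneg hQ₂ x, StochLQ.quad_nonneg hR₂ u]
  obtain ⟨P, hP, hPe⟩ := StochLQ.exists_riccati_solution hAB (hQ₁.add hQ₂) hR
  have hPsol : StochLQ.IsRiccatiSolution D C P := StochLQ.isRiccatiSolution_iff.2 ⟨hP, hPe⟩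
  refine ⟨P, hPsol, fun P' hP' => ?_, ?_⟩
  · obtain ⟨h1, h2⟩ := StochLQ.isRiccatiSolution_iff.1 hP'
    exact StochLQ.riccati_solution_unique hR hS hr hdiss' hP hPe h1 h2
  obtain ⟨q, xt, ut, ht, hpoint⟩ :=
    (C.shift xs us).exists_point_dissipation hAB hQ₁ hR₁ hS hr hdiss
  have herr := StochLQ.isErrorDissipative_of_point (μ := μ) (C.shift xs us) D hQ₂ hR₂ hpoint
  have hV : StochLQ.IsLyapunov (P + S) (D.A + D.B * StochLQ.gain D C P) r :=
    StochLQ.isLyapunov_closedLoop hR hS hr hdiss' hP hPe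
  obtain ⟨ρX, ρU, Xs, Us, hinv, hind, hUs, hst, hmean⟩ :=
    StochLQ.exists_stationaryPair hρW hWmeas hWlaw hWindep hΩ hs ht hV
  exact ⟨S, q, xt, ut, r, hS, hr, ht, herr, ρX, ρU, Xs, Us, hinv, hind, hUs, hst,
    StochLQ.isClassKInfty_mul_left hr,
    StochLQ.exists_le_storage hP hS q xs xt hst.isP2_state hst.law_state,
    fun k _ _ hX hU hXW hUW => StochLQ.dissipation_of_isErrorDissipative hQ₁ hQ₂ hR₁ hR₂ hρW hWlaw
      hs ht hPsol herr hst hUs hmean k hX hU hXW hUW⟩
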